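/- Let $k,l$ be integers with $1\le k<l+1$, put $p=l-k+1\ge 1$, let $f,g$ be real functions analytic at $0$ with $f(0)\neq 0$, and consider the planar system $$\dot z=-w f(z)+z^{l+1}g(z),\qquad \dot w=k z^{2k-1}f(z)+k\,w\,z^{l}g(z).$$ Let $s=\operatorname{sgn} f(0)$ and let $F(z)=s\,g(z)/f(z)$, with Taylor coefficients $F_m$ at $0$ ($s=1$ if the orbits turn counterclockwise, $s=-1$ if they turn clockwise). Then there is $r_0>0$, with $f,g$ analytic and $f\ne0$ on $(-r_0,r_0)$, such that the following holds. (1) The curve $\mathcal T:\ f(z)w=z^{l+1}g(z)$, $0<z<r_0$, is transversal to the vector field. (2) There is a function $Z$, analytic at $0$, $Z(\epsilon)=\sum_n Z_n\epsilon^n$ (convergent), such that for every $r\in(0,r_0]$ there is $\epsilon_0>0$ such that for all $\epsilon\in(0,\epsilon_0)$ the solution starting at the point of $\mathcal T$ with $z=\epsilon$ is unique in $\{|z|<r,|w|<r\}$, stays there until it meets $\mathcal T\cap\{z<r\}$ for the first time after time $0$, and does so at a point with $z=Z(\epsilon)$. (3) $Z(\epsilon)=\epsilon+\sum_{n\ge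 l-k+2}Z_n\epsilon^n$, and the $Z_n$ are given by the following recursion of iterated integrals of algebraic functions. For a power series $F$ let $A_F(z)=1+z^{2p}F(z)^2=\sum_m A_m z^m$, $B_F(z)=2zF'(z)+2(p+2k)F(z)$, and $$P_F(\xi;\delta)=\sum_m \delta^m A_m\frac{2k}{2k+m}\,\frac{1-(1-\xi^2)^{2k+m}}{\xi^2},\qquad v_F(\xi;\delta)=\sum_{n\ge p}\delta^n v_n(\xi),$$ $$v_n(\xi)=2\xi^{-2}\int_0^\xi t^2(1-t^2)^{p+k-1}R_{n-p}(t)\,dt\quad(n\ge p),$$ where $R_n(\xi)$ is the coefficient of $\delta^n$ in $(P_F(\xi;\delta)+v_F(\xi;\delta))^{1/2}B_F(\delta(1-\xi^2))$, which involves only $v_m$ with $m\le n$. Let $D_F(\delta)=P_F(1;\delta)+v_F(1;\delta)$, $(J_2F)(z)=(-1)^{p+k}F(-z)$, $(J_3F)(z)=(-1)^{p+k-1}F(-z)$, and let $\nu_F$ be the power series with $\nu_F(0)=1$ and $\nu_F(\delta)^{2k}D_{J_2F}(\delta\nu_F(\delta))=D_F(\delta)$ (solved recursively coefficient by coefficient).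 Then, for $F=s\,g/f$, $Z(\epsilon)=h(\epsilon)\,\nu_{J_3F}(h(\epsilon))$ with $h(\epsilon)=\epsilon\,\nu_F(\epsilon)$. (4) Explicitly, for $F=s\,g/f$, let $B_0=2(p+2k)F(0)$, $B_1=2(p+2k+1)F'(0)$, $\theta_p=(-1)^{p+k-1}$ and $\Phi_{q,k}(1)=\int_0^1 x^{q+k-1}(1-x^{2k})^{1/2}dx$. If $p\ge2$, then $$Z_{p+1}=2\,\frac{B_0\Phi_{p,k}(1)}{2k}(1+\theta_p),\qquad Z_{p+2}=2\,\frac{B_1\Phi_{p+1,k}(1)}{2k}(1-\theta_p).$$ If $p=1$, then $$Z_2=2\,\frac{B_0\Phi_{1,k}(1)}{2k}(1+\theta_1),$$ $$Z_3=2\left[\frac{(1-\theta_1)B_1\Phi_{2,k}(1)+\frac{1+\theta_1}{k}B_0^2\Phi_{1,k}(1)^2}{2k}+\left(\frac{B_0\Phi_{1,k}(1)}{2k}(1+\theta_1)\right)^2\right].$$ -/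

import Mathlib

noncomputable section

namespace NilpotentReturn

/-! ### The planar system, its transversal and first returns -/

/-- The vector field `ż = -w f(z) + z^(l+1) g(z)`, `ẇ = k z^(2k-1) f(z) + k w z^l g(z)`. -/
def field (k l : ℕ) (f g : ℝ → ℝ) (q : ℝ × ℝ) : ℝ × ℝ :=
  (-q.2 * f q.1 + q.1 ^ (l + 1) * g q.1,
    k * q.1 ^ (2 * k - 1) * f q.1 + k * q.2 * q.1 ^ l * g q.1)

/-- The arc `f(z) w = z^(l+1) g(z)`, `0 < z < r`. -/
def arc (l : ℕ) (f g : ℝ → ℝ) (r : ℝ) : Set (ℝ × ℝ) :=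
  {q | 0 < q.1 ∧ q.1 < r ∧ f q.1 * q.2 = q.1 ^ (l + 1) * g q.1}

/-- `γ` solves `γ' = X(γ)` on `[0, τ]` with `γ(0) = q`, and stays in `U`. -/
structure IsSolutionIn (X : ℝ × ℝ → ℝ × ℝ) (U : Set (ℝ × ℝ)) (q : ℝ × ℝ) (τ : ℝ)
    (γ : ℝ → ℝ × ℝ) : Prop where
  init : γ 0 = q
  hasDeriv : IsIntegralCurveOn γ (fun _ => X) (Set.Icc 0 τ)
  mem : ∀ t ∈ Set.Icc 0 τ, γ t ∈ U

/-- The solution of `γ' = X(γ)` in `U` that starts at `q` exists up to some time `τ > 0`, is unique,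
and meets `T` at a positive time for the first time at time `τ`, at the point `q'`. -/
def IsFirstReturn (X : ℝ × ℝ → ℝ × ℝ) (U T : Set (ℝ × ℝ)) (q q' : ℝ × ℝ) : Prop :=
  ∃ τ > 0, ∃ γ : ℝ → ℝ × ℝ, IsSolutionIn X U q τ γ ∧
    (∀ τ' γ', IsSolutionIn X U q τ' γ' → ∀ t ∈ Set.Icc 0 (min τ τ'), γ' t = γ t) ∧
    γ τ = q' ∧ q' ∈ T ∧ ∀ t ∈ Set.Ioo 0 τ, γ t ∉ T

/-! ### The recursion for the coefficients

In this part `F : ℕ → ℝ` is the sequence of Taylor coefficients at `0` of an analytic function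
`F(z)`, and `p`, `k` are positive integers. -/

/-- Taylor coefficients of `A(z) = 1 + z^(2p) F(z)^2`. -/
def coeffA (p : ℕ) (F : ℕ → ℝ) (m : ℕ) : ℝ :=
  (if m = 0 then 1 else 0) +
    if 2 * p ≤ m then ∑ i ∈ Finset.range (m - 2 * p + 1), F i * F (m - 2 * p - i) else 0

/-- Taylor coefficients of `B(z) = 2 z F'(z) + 2 (p + 2k) F(z)`. -/
def coeffB (p k : ℕ) (F : ℕ → ℝ) (m : ℕ) : ℝ :=
  2 * m * F m + 2 * (p + 2 * k) * F m

/-- The coefficient of `δ^m` in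
`P(ξ; δ) = ξ⁻² ∫_{1-ξ²}^1 2k σ^(2k-1) A(δσ) dσ`, a polynomial in `ξ`:
`A_m · 2k/(2k+m) · (1 - (1-ξ²)^(2k+m)) / ξ²`, the quotient being a geometric sum. -/
def coeffP (p k : ℕ) (F : ℕ → ℝ) (m : ℕ) (ξ : ℝ) : ℝ :=
  coeffA p F m * (2 * k / (2 * k + m)) * ∑ j ∈ Finset.range (2 * k + m), (1 - ξ ^ 2) ^ j

/-- The coefficients `s_n` of the square root of the power series `∑ q_n δ^n`, where `q_0 > 0`:
`s_0 = √q_0` and `s_n = (q_n - ∑_{0<i<n} s_i s_{n-i}) / (2 s_0)`. -/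
def sqrtCoeff (q : ℕ → ℝ) : ℕ → ℝ
  | 0 => √(q 0)
  | n + 1 => (q (n + 1) - ∑ i : Fin n, sqrtCoeff q (i + 1) * sqrtCoeff q (n - i)) / (2 * √(q 0))

/-- The coefficient `R_n` of `δ^n` in `(P(ξ; δ) + v(ξ; δ))^(1/2) B(δ (1 - ξ²))`, where
`v(ξ; δ) = ∑ v_m δ^m`. -/
def coeffR (p k : ℕ) (F : ℕ → ℝ) (v : ℕ → ℝ) (ξ : ℝ) (n : ℕ) : ℝ :=
  ∑ i ∈ Finset.range (n + 1),
    sqrtCoeff (fun m => coeffP p k F m ξ + v m) i * (coeffB p k F (n - i) * (1 - ξ ^ 2) ^ (n - i))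

/-- The recursively defined iterated integrals `v_n(ξ)`: `v_n = 0` for `n < p`, and for `n ≥ p`
`v_n(ξ) = 2 ξ⁻² ∫_0^ξ t² (1-t²)^(p+k-1) R_{n-p}(t) dt`, where `R_{n-p}` only involves
`v_m` with `m ≤ n - p < n`. -/
def coeffV (p k : ℕ) (F : ℕ → ℝ) (n : ℕ) (ξ : ℝ) : ℝ :=
  if n < p then 0 else
    2 * (ξ ^ 2)⁻¹ * ∫ t in (0 : ℝ)..ξ, t ^ 2 * (1 - t ^ 2) ^ (p + k - 1) *
      coeffR p k F (fun m => if _h : m < n then coeffV p k F m t else 0) t (n - p)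
  termination_by n

/-- The coefficients of `D_F(δ) = P(1; δ) + v(1; δ)`. -/
def coeffD (p k : ℕ) (F : ℕ → ℝ) (n : ℕ) : ℝ :=
  coeffP p k F n 1 + coeffV p k F n 1

/-- For power series `d`, `d'` with constant term `1`, the coefficients of the power series `ν`
with constant term `1` such that `ν(δ)^(2k) d'(δ ν(δ)) = d(δ)`. The coefficient of `δ^n` of the
left side is `2k ν_n` plus the same coefficient computed from `ν_0, …, ν_{n-1}` alone. -/
def matchCoeff (k : ℕ) (d d' : ℕ → ℝ) (n : ℕ) : ℝ :=
  if n = 0 then 1 else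
    let ν : PowerSeries ℝ := PowerSeries.mk fun m => if _h : m < n then matchCoeff k d d' m else 0
    (d n - PowerSeries.coeff n (ν ^ (2 * k) *
      ∑ j ∈ Finset.range (n + 1), PowerSeries.C (d' j) * (PowerSeries.X * ν) ^ j)) / (2 * k)
  termination_by n

/-- Taylor coefficients of `(J₂ F)(z) = (-1)^(p+k) F(-z)`. -/
def J₂ (p k : ℕ) (F : ℕ → ℝ) (m : ℕ) : ℝ := (-1) ^ (p + k) * ((-1) ^ m * F m)

/-- Taylor coefficients of `(J₃ F)(z) = (-1)^(p+k-1) F(-z)`. -/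
def J₃ (p k : ℕ) (F : ℕ → ℝ) (m : ℕ) : ℝ := (-1) ^ (p + k - 1) * ((-1) ^ m * F m)

/-- The coefficients of the matching map `ν_F`: the solution with `y(η) = 0` in the half plane
`y ≥ 0` continues to `y(-η̃) = 0` with `η̃ = η ν_F(εη)`, that is,
`η̃^(2k) D_{J₂F}(εη̃) = η^(2k) D_F(εη)`. -/
def coeffN (p k : ℕ) (F : ℕ → ℝ) : ℕ → ℝ :=
  matchCoeff k (coeffD p k F) (coeffD p k (J₂ p k F))

/-- The coefficient `Z_n` of `Z(ε) = h(ε) ν_{J₃F}(h(ε))`, where `h(ε) = ε ν_F(ε)`. -/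
def coeffZ (p k : ℕ) (F : ℕ → ℝ) (n : ℕ) : ℝ :=
  let h : PowerSeries ℝ := PowerSeries.X * PowerSeries.mk (coeffN p k F)
  PowerSeries.coeff n
    (h * ∑ j ∈ Finset.range (n + 1), PowerSeries.C (coeffN p k (J₃ p k F) j) * h ^ j)

/-- `Φ_{p,k}(ξ) = ξ⁻² ∫_{1-ξ²}^1 s^(p+k-1) (1 - s^(2k))^(1/2) ds`. -/
def Phi (p k : ℕ) (ξ : ℝ) : ℝ :=
  (ξ ^ 2)⁻¹ * ∫ s in (1 - ξ ^ 2)..1, s ^ (p + k - 1) * √(1 - s ^ (2 * k))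

/-- The sign `(-1)^(p+k-1)`. -/
def theta (p k : ℕ) : ℝ := (-1) ^ (p + k - 1)

/-- Taylor coefficients at `0` of `F(z) = g(z) / f(z)`, multiplied by the sign of `f(0)`:
the orbits turn counterclockwise if `f(0) > 0` and clockwise if `f(0) < 0`, and the reflection
`w ↦ -w` exchanges the two cases and changes `F` into `-F`. -/
def taylorF (f g : ℝ → ℝ) (n : ℕ) : ℝ :=
  Real.sign (f 0) * (iteratedDeriv n (fun z => g z / f z) 0 / (n.factorial : ℝ))

end NilpotentReturn

end

namespace NilpotentReturn

open Filter Topology Asymptotics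

/-! ### Convergent power series in one real variable -/

/-! Put `y = w - z^(l+1) g(z)/f(z)`. Then `ż = -f y`, the transversal is the half `z > 0` of the
curve `y = 0`, and up to a change of time the system (for `f > 0`) is `ż = -y`, `ẏ = k z^(2k-1) A(z)
+ z^l B(z) y / 2`. An orbit that leaves `y = 0` at `z = δ` is sought as `z = δ(1-ξ²)`, `y = δ^k ξ
S(ξ)` with `ξ` running over `[0,1]`. Integrating the equation for `y²` and dividing by `ξ²` gives
`S² = M(4k(1-t²)^(2k-1) A(δ(1-t²))) + δ^p M(S · 2t(1-t²)^(p+k-1) B(δ(1-t²)))`, where `(Mψ)(ξ) = ξ⁻²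
∫₀^ξ t ψ(t) dt` is the bounded operator `avg` on `C[0,1]`. Written this way, the problem is regular
even at `ξ = 0`.

At `δ = 0` the solution is the square root of a function `≥ 1`, and the linearization in `S` is
multiplication by `2S`, which is invertible. The implicit function theorem in the Banach algebra
`C[0,1]` (`exists_sqrt_solution`) therefore gives `S` analytic in `δ`, and comparison of
coefficients gives exactly the recursion of iterated integrals (`coeffV_eq`). `exists_quarter` turns
the fixed point back into a differential equation.

Sign changes of `z` and `y` carry each of the four quadrants to this model, with `F`, `J₂ F`, `J₃
F`, `J₂ (J₃ F)` in place of `F` (`exists_quarter_orbit`). A quadrant orbit meets `z = 0` at height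
`y² = δ^(2k) D(δ)`, so two adjacent pieces fit together when `η = δ ν(δ)` with `ν^(2k) D'(δν) = D`.
This scalar equation is again solved by the implicit function theorem (`exists_matching`). Composing
the two half turns gives `Z` (`exists_return`); a Lipschitz bound on the field gives uniqueness of
the solution.

The explicit coefficients come from `A = 1 + O(z^(2p))`. Through order `p + 1` only `B₀`, `B₁` and,
for `p = 1`, terms quadratic in `F 0` enter `D`. The part of these that would need a double integral
is the same for `F` and `J₂ F`, and cancels in the matching. -/

theorem _root_.HasSum.congr_terms {E : Type*} [AddCommMonoid E] [TopologicalSpace E]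
    {f g : ℕ → E} {a : E} (h : HasSum f a) (hfg : ∀ n, g n = f n) : HasSum g a := by
  rwa [(funext hfg : g = f)]

section Series

variable {E : Type*} [NormedAddCommGroup E] [NormedSpace ℝ E]

/-- `f` is the sum of the power series with coefficients `a` near `0`. -/
def HasSer (f : ℝ → E) (a : ℕ → E) : Prop :=
  ∀ᶠ x in 𝓝 (0 : ℝ), HasSum (fun n => x ^ n • a n) (f x)

/-- The formal multilinear series with coefficients `a`. -/
def seriesOf (a : ℕ → E) : FormalMultilinearSeries ℝ ℝ E :=
  fun n => ContinuousMultilinearMap.mkPiRing ℝ (Fin n) (a n)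

@[simp] theorem coeff_seriesOf (a : ℕ → E) (n : ℕ) : (seriesOf a).coeff n = a n := by
  simp [FormalMultilinearSeries.coeff, seriesOf]

theorem HasSer.hasFPowerSeriesAt {f : ℝ → E} {a : ℕ → E} (h : HasSer f a) :
    HasFPowerSeriesAt f (seriesOf a) 0 := by
  rw [hasFPowerSeriesAt_iff]
  simpa [HasSer] using h

theorem HasSer.hasFPowerSeriesAt_ofScalars {f : ℝ → ℝ} {a : ℕ → ℝ} (h : HasSer f a) :
    HasFPowerSeriesAt f (FormalMultilinearSeries.ofScalars ℝ a) 0 := by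
  rw [hasFPowerSeriesAt_iff]
  simpa [HasSer] using h

theorem HasSer.analyticAt {f : ℝ → E} {a : ℕ → E} (h : HasSer f a) : AnalyticAt ℝ f 0 :=
  h.hasFPowerSeriesAt.analyticAt

theorem exists_hasSer {f : ℝ → E} (h : AnalyticAt ℝ f 0) : ∃ a, HasSer f a := by
  obtain ⟨p, hp⟩ := h
  rw [hasFPowerSeriesAt_iff] at hp
  exact ⟨p.coeff, by simpa [HasSer] using hp⟩

theorem hasSer_taylor {f : ℝ → ℝ} (h : AnalyticAt ℝ f 0) :
    HasSer f (fun n => iteratedDeriv n f 0 / (n.factorial : ℝ)) := by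
  have := h.hasFPowerSeriesAt
  rw [hasFPowerSeriesAt_iff] at this
  simpa [HasSer] using this

theorem HasSer.congr {f g : ℝ → E} {a : ℕ → E} (h : HasSer f a) (hfg : f =ᶠ[𝓝 0] g) :
    HasSer g a := by
  filter_upwards [h, hfg] with x hx hx'
  rwa [← hx']

theorem HasSer.congr_coeff {f : ℝ → E} {a b : ℕ → E} (h : HasSer f a) (hab : ∀ n, a n = b n) :
    HasSer f b := by
  rwa [← (funext hab : a = b)]

theorem HasSer.unique {f : ℝ → E} {a b : ℕ → E} (ha : HasSer f a) (hb : HasSer f b) : a = b := by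
  have := ha.hasFPowerSeriesAt.eq_formalMultilinearSeries hb.hasFPowerSeriesAt
  funext n
  have h2 := congrArg (fun p => FormalMultilinearSeries.coeff p n) this
  simpa using h2

theorem HasSer.apply_zero {f : ℝ → E} {a : ℕ → E} (h : HasSer f a) : f 0 = a 0 := by
  have h0 : HasSum (fun n => (0 : ℝ) ^ n • a n) (f 0) := mem_of_mem_nhds h
  have h1 : HasSum (fun n => (0 : ℝ) ^ n • a n) ((0 : ℝ) ^ 0 • a 0) :=
    hasSum_single 0 (by intro n hn; simp [hn])
  simpa using h0.unique h1

/-- Convergence at `R/2` bounds the terms there, and at `R/4` they are then dominated by a geometric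
series of ratio `1/2`. -/
theorem HasSer.exists_summable {f : ℝ → E} {a : ℕ → E} (h : HasSer f a) :
    ∃ r > 0, Summable (fun n => r ^ n * ‖a n‖) := by
  obtain ⟨R, hR, h⟩ := Metric.eventually_nhds_iff.1 h
  have h2 := @h (R / 2) (by simp [abs_of_pos hR]; linarith)
  have hb := h2.summable.tendsto_atTop_zero
  have hb' : ∃ C, ∀ n, ‖(R / 2) ^ n • a n‖ ≤ C := by
    obtain ⟨C, hC⟩ := (Metric.isBounded_range_of_tendsto _ hb).exists_norm_le
    exact ⟨C, fun n => hC _ ⟨n, rfl⟩⟩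
  obtain ⟨C, hC⟩ := hb'
  refine ⟨R / 4, by positivity, ?_⟩
  refine Summable.of_nonneg_of_le (fun n => by positivity) (fun n => ?_)
    ((summable_geometric_of_lt_one (r := 1 / 2) (by norm_num) (by norm_num)).mul_left C)
  have h3 := hC n
  rw [norm_smul, norm_pow, Real.norm_of_nonneg (by positivity)] at h3
  calc (R / 4) ^ n * ‖a n‖ = ((R / 2) ^ n * ‖a n‖) * (1 / 2) ^ n := by
        rw [show R / 4 = (R / 2) * (1 / 2) by ring, mul_pow]; ring
    _ ≤ C * (1 / 2) ^ n := by gcongr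

theorem summable_norm_of_abs_le {a : ℕ → E} {r x : ℝ} (hs : Summable (fun n => r ^ n * ‖a n‖))
    (hx : |x| ≤ r) : Summable (fun n => ‖x ^ n • a n‖) := by
  refine Summable.of_nonneg_of_le (fun n => by positivity) (fun n => ?_) hs
  rw [norm_smul, norm_pow, Real.norm_eq_abs]
  gcongr

theorem eventually_abs_le {r : ℝ} (hr : 0 < r) : ∀ᶠ x in 𝓝 (0 : ℝ), |x| ≤ r := by
  filter_upwards [Metric.closedBall_mem_nhds (0 : ℝ) hr] with x hx
  simpa using hx

theorem HasSer.summable_norm {f : ℝ → E} {a : ℕ → E} (h : HasSer f a) :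
    ∀ᶠ x in 𝓝 (0 : ℝ), Summable (fun n => ‖x ^ n • a n‖) := by
  obtain ⟨r, hr, hs⟩ := h.exists_summable
  filter_upwards [eventually_abs_le hr] with x hx
  exact summable_norm_of_abs_le hs hx

theorem hasSer_tsum [CompleteSpace E] {a : ℕ → E} {r : ℝ} (hr : 0 < r)
    (hs : Summable (fun n => r ^ n * ‖a n‖)) : HasSer (fun x => ∑' n, x ^ n • a n) a := by
  filter_upwards [eventually_abs_le hr] with x hx
  exact (summable_norm_of_abs_le hs hx).of_norm.hasSum

theorem HasSer.add {f g : ℝ → E} {a b : ℕ → E} (hf : HasSer f a) (hg : HasSer g b) :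
    HasSer (fun x => f x + g x) (fun n => a n + b n) := by
  filter_upwards [hf, hg] with x h1 h2
  simpa [smul_add] using h1.add h2

theorem HasSer.sub {f g : ℝ → E} {a b : ℕ → E} (hf : HasSer f a) (hg : HasSer g b) :
    HasSer (fun x => f x - g x) (fun n => a n - b n) := by
  filter_upwards [hf, hg] with x h1 h2
  simpa [smul_sub] using h1.sub h2

theorem HasSer.clm {G : Type*} [NormedAddCommGroup G] [NormedSpace ℝ G] {f : ℝ → E} {a : ℕ → E}
    (hf : HasSer f a) (T : E →L[ℝ] G) : HasSer (fun x => T (f x)) (fun n => T (a n)) := by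
  filter_upwards [hf] with x h1
  simpa using T.hasSum h1

theorem HasSer.pow_smul {f : ℝ → E} {a : ℕ → E} (hf : HasSer f a) (p : ℕ) :
    HasSer (fun x => x ^ p • f x) (fun n => if p ≤ n then a (n - p) else 0) := by
  filter_upwards [hf] with x h1
  have h2 := h1.const_smul (x ^ p)
  rw [← hasSum_nat_add_iff' p, Finset.sum_eq_zero, sub_zero]
  · refine h2.congr_terms fun n => ?_
    simp [pow_add, smul_smul, mul_comm]
  · intro i hi
    simp [not_le.2 (Finset.mem_range.1 hi)]

theorem HasSer.mul {A : Type*} [NormedRing A] [NormedAlgebra ℝ A] [CompleteSpace A]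
    {f g : ℝ → A} {a b : ℕ → A} (hf : HasSer f a) (hg : HasSer g b) :
    HasSer (fun x => f x * g x) (fun n => ∑ i ∈ Finset.range (n + 1), a i * b (n - i)) := by
  filter_upwards [hf, hg, hf.summable_norm, hg.summable_norm] with x h1 h2 h3 h4
  have h5 := hasSum_sum_range_mul_of_summable_norm h3 h4
  rw [h1.tsum_eq, h2.tsum_eq] at h5
  refine h5.congr_terms fun n => ?_
  rw [Finset.smul_sum]
  refine Finset.sum_congr rfl fun i hi => ?_
  have : i + (n - i) = n := by have := Finset.mem_range.1 hi; omega
  rw [smul_mul_smul_comm, ← pow_add, this]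

theorem HasSer.isBigO {f : ℝ → E} {a : ℕ → E} (hf : HasSer f a) (n : ℕ) :
    (fun x => f x - ∑ i ∈ Finset.range n, x ^ i • a i) =O[𝓝 0] fun x => x ^ n := by
  have h := hf.hasFPowerSeriesAt.isBigO_sub_partialSum_pow n
  simp only [zero_add, FormalMultilinearSeries.partialSum, seriesOf,
    ContinuousMultilinearMap.mkPiRing_apply, Finset.prod_const, Finset.card_univ,
    Fintype.card_fin] at h
  refine h.trans (IsBigO.of_bound 1 (Eventually.of_forall fun x => ?_))
  simp

/-- Once the coefficients below `m` vanish, the Taylor estimate leaves `x^m a_m = O(x^(m+1))`.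
Dividing by `x^m` and letting `x → 0` kills `a_m`. -/
theorem HasSer.coeff_eq_zero_of_isBigO {f : ℝ → E} {a : ℕ → E} (hf : HasSer f a) {n : ℕ}
    (h : f =O[𝓝 0] fun x => x ^ n) : ∀ m < n, a m = 0 := by
  intro m
  induction m using Nat.strong_induction_on with
  | _ m ih =>
    intro hm
    have h1 := hf.isBigO (m + 1)
    have h2 : f =O[𝓝 0] fun x : ℝ => x ^ (m + 1) := h.trans (isBigO_pow_of_lt hm)
    have h3 : (fun x : ℝ => x ^ m • a m) =O[𝓝 0] fun x : ℝ => x ^ (m + 1) := by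
      refine (h2.sub h1).congr_left fun x => ?_
      rw [Finset.sum_range_succ, Finset.sum_eq_zero]
      · simp
      · intro i hi
        have := Finset.mem_range.1 hi
        simp [ih i this (this.trans hm)]
    obtain ⟨C, hC⟩ := h3.bound
    have h4 : ∀ᶠ x in 𝓝[≠] (0 : ℝ), ‖a m‖ ≤ C * |x| := by
      filter_upwards [hC.filter_mono nhdsWithin_le_nhds, self_mem_nhdsWithin] with x hx hx0
      have hx0 : 0 < |x| := abs_pos.2 hx0
      rw [norm_smul, norm_pow, norm_pow, Real.norm_eq_abs, pow_succ] at hx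
      have : 0 < |x| ^ m := by positivity
      refine le_of_mul_le_mul_left ?_ this
      linarith
    have h5 : Tendsto (fun x : ℝ => C * |x|) (𝓝[≠] 0) (𝓝 0) := by
      have : Continuous fun x : ℝ => C * |x| := by fun_prop
      simpa using (this.tendsto 0).mono_left nhdsWithin_le_nhds
    have := ge_of_tendsto h5 h4
    simpa using this
where
  isBigO_pow_of_lt {m n : ℕ} (h : m < n) :
      (fun x : ℝ => x ^ n) =O[𝓝 0] fun x : ℝ => x ^ (m + 1) := by
    obtain ⟨k, rfl⟩ := Nat.exists_eq_add_of_le (Nat.succ_le_of_lt h)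
    have : (fun x : ℝ => x ^ k) =O[𝓝 0] fun _ => (1 : ℝ) :=
      ((continuous_pow k).tendsto 0).isBigO_one ℝ
    simpa [pow_add] using (isBigO_refl (fun x : ℝ => x ^ (m + 1)) (𝓝 0)).mul this

end Series

end NilpotentReturn

namespace NilpotentReturn

open Filter Topology Asymptotics PowerSeries

/-! ### Products and compositions -/

/-- `f` is analytic at `0` with Taylor series `A`. -/
def HasPS (f : ℝ → ℝ) (A : PowerSeries ℝ) : Prop := HasSer f fun n => coeff n A

theorem hasPS_mk {f : ℝ → ℝ} {a : ℕ → ℝ} : HasPS f (PowerSeries.mk a) ↔ HasSer f a := by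
  simp [HasPS]

theorem HasPS.mul {f g : ℝ → ℝ} {A B : PowerSeries ℝ} (hf : HasPS f A) (hg : HasPS g B) :
    HasPS (fun x => f x * g x) (A * B) := by
  refine (HasSer.mul hf hg).congr_coeff fun n => ?_
  rw [coeff_mul, Finset.Nat.sum_antidiagonal_eq_sum_range_succ_mk]

theorem HasPS.add {f g : ℝ → ℝ} {A B : PowerSeries ℝ} (hf : HasPS f A) (hg : HasPS g B) :
    HasPS (fun x => f x + g x) (A + B) :=
  (HasSer.add hf hg).congr_coeff fun n => by simp

theorem hasPS_C (c : ℝ) : HasPS (fun _ => c) (C c) := by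
  refine Eventually.of_forall fun x => ?_
  have h := hasSum_single (f := fun n => x ^ n • coeff n (C c : PowerSeries ℝ)) 0
    (by intro n hn; simp [coeff_C, hn])
  simpa using h

theorem hasPS_X : HasPS (fun x => x) X := by
  refine Eventually.of_forall fun x => ?_
  have h := hasSum_single (f := fun n => x ^ n • coeff n (X : PowerSeries ℝ)) 1
    (by intro n hn; simp [coeff_X, hn])
  simpa [coeff_X] using h

theorem HasPS.pow {f : ℝ → ℝ} {A : PowerSeries ℝ} (hf : HasPS f A) (n : ℕ) :
    HasPS (fun x => f x ^ n) (A ^ n) := by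
  induction n with
  | zero => simpa using hasPS_C 1
  | succ n ih => simpa [pow_succ] using ih.mul hf

theorem HasPS.sum {f : ℕ → ℝ → ℝ} {A : ℕ → PowerSeries ℝ} (h : ∀ i, HasPS (f i) (A i)) (n : ℕ) :
    HasPS (fun x => ∑ i ∈ Finset.range n, f i x) (∑ i ∈ Finset.range n, A i) := by
  induction n with
  | zero => simpa using hasPS_C 0
  | succ n ih => simpa [Finset.sum_range_succ] using ih.add (h n)

/-- The composition `c ∘ H` of power series, where `H` has no constant term. -/
noncomputable def psComp (c : ℕ → ℝ) (H : PowerSeries ℝ) : PowerSeries ℝ :=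
  PowerSeries.mk fun n => coeff n (∑ j ∈ Finset.range (n + 1), C (c j) * H ^ j)

/-- Since `X ∣ H`, the terms `H^j` with `j > n` do not reach degree `n`, so the place of truncation
is immaterial. -/
theorem coeff_psComp {c : ℕ → ℝ} {H : PowerSeries ℝ} (hH : X ∣ H) {n N : ℕ} (h : n ≤ N) :
    coeff n (psComp c H) = coeff n (∑ j ∈ Finset.range (N + 1), C (c j) * H ^ j) := by
  rw [psComp, coeff_mk, ← Finset.sum_range_add_sum_Ico _ (Nat.succ_le_succ h), map_add]
  rw [left_eq_add, map_sum]
  refine Finset.sum_eq_zero fun j hj => ?_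
  have hj := (Finset.mem_Ico.1 hj).1
  have : X ^ (n + 1) ∣ C (c j) * H ^ j :=
    ((pow_dvd_pow X hj).trans (pow_dvd_pow_of_dvd hH j)).mul_left _
  exact X_pow_dvd_iff.1 this n (Nat.lt_succ_self n)

theorem X_pow_dvd_psComp_sub {c : ℕ → ℝ} {H : PowerSeries ℝ} (hH : X ∣ H) (n : ℕ) :
    X ^ (n + 1) ∣ psComp c H - ∑ j ∈ Finset.range (n + 1), C (c j) * H ^ j := by
  rw [X_pow_dvd_iff]
  intro m hm
  rw [map_sub, coeff_psComp hH (Nat.lt_succ_iff.1 hm), sub_self]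

theorem coeff_mul_psComp {c : ℕ → ℝ} {H : PowerSeries ℝ} (hH : X ∣ H) (A : PowerSeries ℝ) (n : ℕ) :
    coeff n (A * psComp c H) = coeff n (A * ∑ j ∈ Finset.range (n + 1), C (c j) * H ^ j) := by
  have := X_pow_dvd_iff.1 ((X_pow_dvd_psComp_sub (c := c) hH n).mul_left A) n (Nat.lt_succ_self n)
  rwa [mul_sub, map_sub, sub_eq_zero] at this

/-- No rearrangement of double series is needed: the composite is analytic, hence has some Taylor
series, and it differs from the truncated polynomial in `h` by `O(x^(n+1))`, which identifies the
coefficient of degree `n`. -/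
theorem HasPS.comp {φ h : ℝ → ℝ} {c : ℕ → ℝ} {H : PowerSeries ℝ} (hφ : HasSer φ c)
    (hh : HasPS h H) (hH : X ∣ H) : HasPS (fun x => φ (h x)) (psComp c H) := by
  have hH0 : coeff 0 H = 0 := by simpa using X_dvd_iff.1 hH
  have h0 : h 0 = 0 := by rw [HasSer.apply_zero hh, hH0]
  have hlim : Tendsto h (𝓝 0) (𝓝 0) := by
    have := (HasSer.analyticAt hh).continuousAt.tendsto
    rwa [h0] at this
  have hhO : h =O[𝓝 0] fun x : ℝ => x := by
    simpa [hH0] using HasSer.isBigO hh 1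
  obtain ⟨b, hb⟩ := exists_hasSer (f := fun x => φ (h x)) (by
    have h1 := hφ.analyticAt
    rw [← h0] at h1
    exact h1.comp (HasSer.analyticAt hh))
  refine hb.congr_coeff fun n => ?_
  have h1 : (fun x => φ (h x) - ∑ j ∈ Finset.range (n + 1), c j * h x ^ j)
      =O[𝓝 0] fun x : ℝ => x ^ (n + 1) := by
    refine ((hφ.isBigO (n + 1)).comp_tendsto hlim).trans (hhO.pow (n + 1)) |>.congr_left ?_
    intro x
    simp [mul_comm]
  have h2 : HasPS (fun x => ∑ j ∈ Finset.range (n + 1), c j * h x ^ j)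
      (∑ j ∈ Finset.range (n + 1), C (c j) * H ^ j) :=
    HasPS.sum (fun j => (hasPS_C (c j)).mul (hh.pow j)) (n + 1)
  have h3 := (hb.sub h2).coeff_eq_zero_of_isBigO h1 n (Nat.lt_succ_self n)
  rw [psComp, coeff_mk]
  exact sub_eq_zero.1 h3

/-! ### The matching map -/

theorem matchCoeff_zero (k : ℕ) (d d' : ℕ → ℝ) : matchCoeff k d d' 0 = 1 := by
  rw [matchCoeff]; simp

/-- The recursion `matchCoeff` solves `ν^(2k) d'(δ ν) = d`, and is the only solution. -/
theorem eq_matchCoeff {k : ℕ} (hk : 1 ≤ k) {d d' : ℕ → ℝ} (hd' : d' 0 = 1) {a : ℕ → ℝ}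
    (h0 : a 0 = 1)
    (h : ∀ n, coeff n (PowerSeries.mk a ^ (2 * k) * psComp d' (X * PowerSeries.mk a)) = d n) :
    ∀ n, a n = matchCoeff k d d' n := by
  intro n
  induction n using Nat.strong_induction_on with
  | _ n ih =>
    rw [matchCoeff]
    split_ifs with hn
    · rw [hn, h0]
    have htr : (PowerSeries.mk fun m => if _h : m < n then matchCoeff k d d' m else 0)
        = PowerSeries.mk fun m => if m < n then a m else 0 := by
      ext m
      simp only [coeff_mk]
      split_ifs with hm
      · exact (ih m hm).symm
      · rfl
    simp only [htr]
    set N := PowerSeries.mk a with hN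
    set T : PowerSeries ℝ := PowerSeries.mk fun m => if m < n then a m else 0 with hT
    have hT0 : constantCoeff T = 1 := by
      rw [← coeff_zero_eq_constantCoeff_apply, hT, coeff_mk, if_pos (Nat.pos_of_ne_zero hn), h0]
    have hNT : X ^ (n + 1) ∣ N - T - C (a n) * X ^ n := by
      rw [X_pow_dvd_iff]
      intro m hm
      simp only [hN, hT, map_sub, coeff_mk, coeff_C_mul, coeff_X_pow]
      rcases Nat.lt_succ_iff_lt_or_eq.1 hm with h1 | h1
      · simp [h1, h1.ne]
      · simp [h1]
    -- The additional factor `X` pushes the unknown `a n` to degree `n + 1`, so it is invisible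
    -- inside `d'` and enters only through `N ^ (2 * k)`, linearly.
    have hX : X ^ (n + 1) ∣ X * N - X * T := by
      rw [← mul_sub, pow_succ']
      refine mul_dvd_mul_left X ?_
      have h2 : X ^ n ∣ N - T - C (a n) * X ^ n := (pow_dvd_pow X n.le_succ).trans hNT
      simpa using h2.add (Dvd.intro_left (C (a n)) rfl : X ^ n ∣ C (a n) * X ^ n)
    have hXN : X ∣ X * N := Dvd.intro N rfl
    have hn1 := h n
    rw [coeff_mul_psComp hXN] at hn1
    set SN : PowerSeries ℝ := ∑ j ∈ Finset.range (n + 1), C (d' j) * (X * N) ^ j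
    set ST : PowerSeries ℝ := ∑ j ∈ Finset.range (n + 1), C (d' j) * (X * T) ^ j with hST
    have hS : X ^ (n + 1) ∣ SN - ST := by
      rw [← Finset.sum_sub_distrib]
      refine Finset.dvd_sum fun j _ => ?_
      rw [← mul_sub]
      exact (hX.trans (sub_dvd_pow_sub_pow _ _ j)).mul_left _
    have hST0 : constantCoeff ST = 1 := by
      rw [hST, map_sum, Finset.sum_eq_single 0]
      · simp [hd']
      · intro j _ hj; simp [hj]
      · simp
    -- the effect of the last coefficient
    have hpow : X ^ (n + 1) ∣ N ^ (2 * k) - (T ^ (2 * k) + C (2 * k * a n) * X ^ n) := by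
      obtain ⟨R, hR⟩ := hNT
      have hNe : N = T + X ^ n * (C (a n) + X * R) := by
        have : N = T + C (a n) * X ^ n + X ^ (n + 1) * R := by rw [← hR]; ring
        rw [this]; ring
      obtain ⟨Q, hQ⟩ := Polynomial.powAddExpansion T (X ^ n * (C (a n) + X * R)) (2 * k)
      have hT1 : X ∣ T ^ (2 * k - 1) - 1 := by
        rw [X_dvd_iff]; simp [hT0]
      obtain ⟨W, hW⟩ := hT1
      have hW' : T ^ (2 * k - 1) = 1 + X * W := by rw [← hW]; ring
      obtain ⟨m, rfl⟩ : ∃ m, n = m + 1 := Nat.exists_eq_succ_of_ne_zero hn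
      refine ⟨(2 * k : PowerSeries ℝ) * (W * (C (a (m + 1)) + X * R) + R)
        + Q * (X ^ m * (C (a (m + 1)) + X * R) ^ 2), ?_⟩
      rw [hNe, hQ, hW']
      push_cast
      simp only [map_mul, map_natCast, map_ofNat]
      ring
    have h1 : X ^ (n + 1) ∣ N ^ (2 * k) * SN - (T ^ (2 * k) + C (2 * k * a n) * X ^ n) * ST := by
      have : N ^ (2 * k) * SN - (T ^ (2 * k) + C (2 * k * a n) * X ^ n) * ST =
        (N ^ (2 * k) - (T ^ (2 * k) + C (2 * k * a n) * X ^ n)) * ST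
          + N ^ (2 * k) * (SN - ST) := by ring
      rw [this]
      exact (hpow.mul_right _).add (hS.mul_left _)
    have h2 := X_pow_dvd_iff.1 h1 n (Nat.lt_succ_self n)
    rw [map_sub, hn1, add_mul, map_add, mul_assoc, coeff_C_mul] at h2
    have h3 : coeff n (X ^ n * ST) = 1 := by
      have := coeff_X_pow_mul ST n 0
      rw [zero_add] at this
      rw [this, coeff_zero_eq_constantCoeff_apply, hST0]
    rw [h3] at h2
    have hk' : (k : ℝ) ≠ 0 := by positivity
    field_simp
    linarith

-- Implicit function theorem for `t^(2k) D'(x t) - D(x)` at `(0, 1)`: along `x = 0` this is `t^(2k)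
-- - 1`, with derivative `2k ≠ 0` at `t = 1`. The Taylor coefficients of the solution are then
-- forced by `eq_matchCoeff`.
open scoped ContDiff in
theorem exists_matching {k : ℕ} (hk : 1 ≤ k) {d d' : ℕ → ℝ} {D D' : ℝ → ℝ} (hD : HasSer D d)
    (hD' : HasSer D' d') (hd : d 0 = 1) (hd' : d' 0 = 1) :
    ∃ ν : ℝ → ℝ, HasSer ν (matchCoeff k d d') ∧
      ∀ᶠ x in 𝓝 (0 : ℝ), ν x ^ (2 * k) * D' (x * ν x) = D x := by
  have hD0 : D 0 = 1 := by rw [hD.apply_zero, hd]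
  have hD'0 : D' 0 = 1 := by rw [hD'.apply_zero, hd']
  let Φ : ℝ × ℝ → ℝ := fun q => q.2 ^ (2 * k) * D' (q.1 * q.2) - D q.1
  have hΦ : ContDiffAt ℝ ω Φ (0, 1) := by
    have h1 : ContDiffAt ℝ ω D (0, (1 : ℝ)).1 := hD.analyticAt.contDiffAt
    have h2 : ContDiffAt ℝ ω D' ((0, (1 : ℝ)).1 * (0, (1 : ℝ)).2) := by
      simpa using hD'.analyticAt.contDiffAt
    have h3 : ContDiffAt ℝ ω (fun q : ℝ × ℝ => D' (q.1 * q.2)) (0, 1) :=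
      ContDiffAt.comp (g := D') (0, (1 : ℝ)) h2 (contDiffAt_fst.mul contDiffAt_snd)
    have h4 : ContDiffAt ℝ ω (fun q : ℝ × ℝ => D q.1) (0, 1) :=
      ContDiffAt.comp (g := D) (0, (1 : ℝ)) h1 contDiffAt_fst
    exact ((contDiffAt_snd.pow _).mul h3).sub h4
  have hinv : (fderiv ℝ Φ (0, 1) ∘L .inr ℝ ℝ ℝ).IsInvertible := by
    have h1 : HasFDerivAt (fun t : ℝ => Φ (0, t)) (fderiv ℝ Φ (0, 1) ∘L .inr ℝ ℝ ℝ) 1 := by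
      have := (hΦ.differentiableAt (by simp)).hasFDerivAt
      exact this.comp (1 : ℝ) (hasFDerivAt_prodMk_right (0 : ℝ) (1 : ℝ))
    have h2 : HasDerivAt (fun t : ℝ => Φ (0, t)) (2 * k) 1 := by
      have h3 : (fun t : ℝ => Φ (0, t)) = fun t => t ^ (2 * k) - 1 := by
        funext t; simp [Φ, hD0, hD'0]
      rw [h3]
      simpa using (hasDerivAt_pow (2 * k) (1 : ℝ)).sub_const 1
    rw [h1.unique h2.hasFDerivAt]
    have hk' : (2 * k : ℝ) ≠ 0 := by positivity
    refine ⟨ContinuousLinearEquiv.unitsEquivAut ℝ (Units.mk0 _ hk'), ?_⟩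
    ext
    simp
  set ν := hΦ.implicitFunction (by simp) hinv with hν
  have hν1 : ν 0 = 1 := hΦ.implicitFunction_apply_self (by simp) hinv
  have hνa : AnalyticAt ℝ ν 0 := (hΦ.contDiffAt_implicitFunction (by simp) hinv).analyticAt
  have heq : ∀ᶠ x in 𝓝 (0 : ℝ), ν x ^ (2 * k) * D' (x * ν x) = D x := by
    filter_upwards [hΦ.eventually_apply_implicitFunction (by simp) hinv] with x hx
    simpa [Φ, hD0, hD'0, sub_eq_zero] using hx
  refine ⟨ν, ?_, heq⟩
  obtain ⟨a, ha⟩ := exists_hasSer hνa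
  have ha0 : a 0 = 1 := by rw [← ha.apply_zero, hν1]
  have hN := hasPS_mk.2 ha
  have hXN := hasPS_X.mul hN
  have hfull := (hN.pow (2 * k)).mul (HasPS.comp hD' hXN (Dvd.intro _ rfl))
  have := (HasSer.congr hfull heq).unique hD
  exact ha.congr_coeff (eq_matchCoeff hk hd' ha0 fun n => congrFun this n)

/-- The composition of two matching maps. -/
theorem hasSer_coeffZ {p k : ℕ} {F : ℕ → ℝ} {ν ν' : ℝ → ℝ} (hν : HasSer ν (coeffN p k F))
    (hν' : HasSer ν' (coeffN p k (J₃ p k F))) :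
    HasSer (fun x => x * ν x * ν' (x * ν x)) (coeffZ p k F) := by
  have hh := hasPS_X.mul (hasPS_mk.2 hν)
  have hX : X ∣ X * PowerSeries.mk (coeffN p k F) := Dvd.intro _ rfl
  refine HasSer.congr_coeff (hh.mul (HasPS.comp hν' hh hX)) fun n => ?_
  rw [coeff_mul_psComp hX, coeffZ]

end NilpotentReturn

namespace NilpotentReturn

open Filter Topology Set

/-! ### An averaging operator -/

/-- Continuous functions on `[0, 1]`. -/
abbrev CI : Type := C(Icc (0 : ℝ) 1, ℝ)

/-- The extension of a function on `[0, 1]` by constants. -/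
noncomputable def ext (ψ : CI) : ℝ → ℝ := IccExtend zero_le_one ψ

theorem continuous_ext (ψ : CI) : Continuous (ext ψ) := ψ.continuous.Icc_extend'

theorem ext_of_mem (ψ : CI) {x : ℝ} (hx : x ∈ Icc (0 : ℝ) 1) : ext ψ x = ψ ⟨x, hx⟩ :=
  IccExtend_of_mem _ _ hx

theorem ext_coe (ψ : CI) (x : Icc (0 : ℝ) 1) : ext ψ x = ψ x := IccExtend_val _ _ x

theorem abs_ext_le (ψ : CI) (x : ℝ) : |ext ψ x| ≤ ‖ψ‖ := ψ.norm_coe_le_norm _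

/-- The operator `(M ψ)(ξ) = ∫₀¹ s ψ(sξ) ds = ξ⁻² ∫₀^ξ t ψ(t) dt`. -/
noncomputable def avg : CI →L[ℝ] CI :=
  LinearMap.mkContinuous
    { toFun := fun ψ => ⟨fun ξ => ∫ s in (0 : ℝ)..1, s * ext ψ (s * ξ), by
        refine intervalIntegral.continuous_parametric_intervalIntegral_of_continuous' ?_ _ _
        have := continuous_ext ψ
        fun_prop⟩
      map_add' := fun ψ χ => by
        ext ξ
        simp only [ContinuousMap.coe_mk, ContinuousMap.add_apply]
        have h1 := continuous_ext ψ
        have h2 := continuous_ext χ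
        rw [← intervalIntegral.integral_add
          ((by fun_prop : Continuous _).intervalIntegrable _ _)
          ((by fun_prop : Continuous _).intervalIntegrable _ _)]
        congr 1; funext s
        simp [ext, IccExtend, mul_add]
      map_smul' := fun c ψ => by
        ext ξ
        simp only [ContinuousMap.coe_mk, ContinuousMap.smul_apply, RingHom.id_apply, smul_eq_mul]
        rw [← intervalIntegral.integral_const_mul]
        congr 1; funext s
        simp [ext, IccExtend]; ring }
    1 (fun ψ => by
      rw [one_mul, ContinuousMap.norm_le _ (norm_nonneg _)]
      intro ξ
      have := intervalIntegral.norm_integral_le_of_norm_le_const (a := 0) (b := 1) (C := ‖ψ‖)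
        (f := fun s : ℝ => s * ext ψ (s * ξ)) (by
          intro s hs
          rw [uIoc_of_le zero_le_one] at hs
          rw [norm_mul, Real.norm_of_nonneg hs.1.le, Real.norm_eq_abs]
          calc s * |ext ψ (s * ξ)| ≤ 1 * ‖ψ‖ := by
                have := abs_ext_le ψ (s * ξ)
                have := hs.2
                gcongr
            _ = ‖ψ‖ := one_mul _)
      simpa using this)

theorem avg_apply (ψ : CI) (ξ : Icc (0 : ℝ) 1) :
    avg ψ ξ = ∫ s in (0 : ℝ)..1, s * ext ψ (s * ξ) := rfl

theorem sq_mul_avg (ψ : CI) (ξ : Icc (0 : ℝ) 1) :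
    (ξ : ℝ) ^ 2 * avg ψ ξ = ∫ t in (0 : ℝ)..ξ, t * ext ψ t := by
  have h := intervalIntegral.mul_integral_comp_mul_right (a := 0) (b := 1)
    (f := fun t => t * ext ψ t) (ξ : ℝ)
  rw [zero_mul, one_mul] at h
  rw [← h, avg_apply, sq, mul_assoc, ← intervalIntegral.integral_const_mul (ξ : ℝ)]
  congr 2; funext s; ring

theorem avg_zero (ψ : CI) (ξ : Icc (0 : ℝ) 1) (h : (ξ : ℝ) = 0) : avg ψ ξ = ψ ξ / 2 := by
  have : ∀ s : ℝ, s * ext ψ (s * ξ) = s * ψ ξ := by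
    intro s
    rw [← ext_coe ψ ξ]; simp [h]
  simp only [avg_apply, this, intervalIntegral.integral_mul_const, integral_id]
  ring

/-! ### Dilations of an analytic function -/

/-- The function `1 - t²`. -/
noncomputable def oneSubSq : CI := ⟨fun t => 1 - (t : ℝ) ^ 2, by fun_prop⟩

@[simp] theorem oneSubSq_apply (t : Icc (0 : ℝ) 1) : oneSubSq t = 1 - (t : ℝ) ^ 2 := rfl

theorem oneSubSq_nonneg (t : Icc (0 : ℝ) 1) : 0 ≤ 1 - (t : ℝ) ^ 2 := by
  have h0 := t.2.1; have h1 := t.2.2; nlinarith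

theorem norm_oneSubSq_le : ‖oneSubSq‖ ≤ 1 := by
  rw [ContinuousMap.norm_le _ zero_le_one]
  intro t
  rw [oneSubSq_apply, Real.norm_of_nonneg (oneSubSq_nonneg t)]
  nlinarith [sq_nonneg (t : ℝ)]

/-- Because `1 - t²` has sup norm at most `1`, replacing `c n` by `c n (1-t²)^n` preserves
summability. The dilation thus becomes an analytic curve in `C[0,1]`, to which Banach space calculus
applies. -/
theorem exists_dilation {φ : ℝ → ℝ} {c : ℕ → ℝ} (h : HasSer φ c) :
    ∃ Φ : ℝ → CI, HasSer Φ (fun n => c n • oneSubSq ^ n) ∧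
      ∀ᶠ δ in 𝓝 (0 : ℝ), ∀ t, Φ δ t = φ (δ * (1 - (t : ℝ) ^ 2)) := by
  obtain ⟨r, hr, hs⟩ := h.exists_summable
  have hle : ∀ n, ‖c n • oneSubSq ^ n‖ ≤ ‖c n‖ := fun n => by
    calc ‖c n • oneSubSq ^ n‖ ≤ ‖c n‖ * ‖oneSubSq ^ n‖ := (norm_smul (c n) (oneSubSq ^ n)).le
      _ ≤ ‖c n‖ * 1 := by
        gcongr
        exact (norm_pow_le _ n).trans (pow_le_one₀ (norm_nonneg _) norm_oneSubSq_le)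
      _ = ‖c n‖ := mul_one _
  have hs' : Summable fun n => r ^ n * ‖c n • oneSubSq ^ n‖ :=
    Summable.of_nonneg_of_le (fun n => by positivity)
      (fun n => mul_le_mul_of_nonneg_left (hle n) (by positivity)) hs
  have hΦ := hasSer_tsum hr hs'
  refine ⟨_, hΦ, ?_⟩
  obtain ⟨R, hR, hφ⟩ := Metric.eventually_nhds_iff.1 h
  filter_upwards [hΦ, Metric.ball_mem_nhds (0 : ℝ) hR] with δ h1 h2 t
  have h3 := (ContinuousMap.evalCLM ℝ t).hasSum h1
  have h4 : dist (δ * (1 - (t : ℝ) ^ 2)) 0 < R := by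
    rw [Metric.mem_ball, dist_zero_right, Real.norm_eq_abs] at h2
    rw [dist_zero_right, Real.norm_eq_abs, abs_mul, abs_of_nonneg (oneSubSq_nonneg t)]
    refine lt_of_le_of_lt ?_ h2
    exact mul_le_of_le_one_right (abs_nonneg _) (by nlinarith [sq_nonneg (t : ℝ)])
  refine h3.unique ((hφ h4).congr_terms fun n => ?_)
  simp [mul_pow]
  ring

/-! ### Uniqueness in the recursion -/

theorem sqrtCoeff_congr {q q' : ℕ → ℝ} (n : ℕ) (h : ∀ m ≤ n, q m = q' m) :
    sqrtCoeff q n = sqrtCoeff q' n := by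
  induction n using Nat.strong_induction_on with
  | _ n ih =>
    cases n with
    | zero => simp [sqrtCoeff, h 0 le_rfl]
    | succ n =>
      rw [sqrtCoeff, sqrtCoeff, h 0 (Nat.zero_le _), h (n + 1) le_rfl]
      congr 2
      refine Finset.sum_congr rfl fun i _ => ?_
      have hi := i.2
      rw [ih (i + 1) (by omega) fun m hm => h m (by omega),
        ih (n - i) (by omega) fun m hm => h m (by omega)]

/-- The recursion inverts the Cauchy square; positivity of `s 0` selects the branch of the root. -/
theorem sqrtCoeff_sq {s : ℕ → ℝ} (h0 : 0 < s 0) (n : ℕ) :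
    sqrtCoeff (fun m => ∑ i ∈ Finset.range (m + 1), s i * s (m - i)) n = s n := by
  have hs0 : √(s 0 * s 0) = s 0 := Real.sqrt_mul_self h0.le
  induction n using Nat.strong_induction_on with
  | _ n ih =>
    cases n with
    | zero => simp [sqrtCoeff, hs0]
    | succ n =>
      rw [sqrtCoeff]
      simp only [zero_add, Finset.sum_range_one, Nat.sub_zero, hs0]
      have h1 : ∑ i : Fin n, sqrtCoeff (fun m => ∑ i ∈ Finset.range (m + 1), s i * s (m - i)) (i + 1)
          * sqrtCoeff (fun m => ∑ i ∈ Finset.range (m + 1), s i * s (m - i)) (n - i)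
          = ∑ i ∈ Finset.range n, s (i + 1) * s (n - i) := by
        rw [← Fin.sum_univ_eq_sum_range (fun i => s (i + 1) * s (n - i))]
        refine Finset.sum_congr rfl fun i _ => ?_
        have hi := i.2
        rw [ih (i + 1) (by omega), ih (n - i) (by omega)]
      rw [h1, Finset.sum_range_succ', Finset.sum_range_succ]
      have h2 : ∀ i, n + 1 - (i + 1) = n - i := fun i => by omega
      simp only [h2, Nat.sub_self, Nat.sub_zero]
      field_simp
      ring

theorem coeffA_zero {p : ℕ} (hp : 1 ≤ p) (F : ℕ → ℝ) : coeffA p F 0 = 1 := by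
  have : p ≠ 0 := by omega
  simp [coeffA, this]

theorem one_le_coeffP {p k : ℕ} (hp : 1 ≤ p) (hk : 1 ≤ k) (F : ℕ → ℝ) (ξ : Icc (0 : ℝ) 1) :
    1 ≤ coeffP p k F 0 ξ := by
  have hk' : (2 * k : ℝ) ≠ 0 := by positivity
  rw [coeffP, coeffA_zero hp, Nat.cast_zero, add_zero, add_zero, div_self hk', one_mul, one_mul]
  have h := Finset.single_le_sum (f := fun j => (1 - (ξ : ℝ) ^ 2) ^ j) (s := Finset.range (2 * k))
    (fun j _ => pow_nonneg (oneSubSq_nonneg ξ) j) (Finset.mem_range.2 (by omega : 0 < 2 * k))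
  simpa using h

/-- The weight `4 k (1 - t²)^(2k-1)`. -/
noncomputable def weightA (k : ℕ) : CI := (4 * k : ℝ) • oneSubSq ^ (2 * k - 1)

/-- The weight `2 t (1 - t²)^(p+k-1)`. -/
noncomputable def weightB (p k : ℕ) : CI :=
  (2 : ℝ) • ((⟨fun t => (t : ℝ), by fun_prop⟩ : CI) * oneSubSq ^ (p + k - 1))

theorem weightA_apply (k : ℕ) (t : Icc (0 : ℝ) 1) :
    weightA k t = 4 * k * (1 - (t : ℝ) ^ 2) ^ (2 * k - 1) := by
  simp [weightA]

theorem weightB_apply (p k : ℕ) (t : Icc (0 : ℝ) 1) :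
    weightB p k t = 2 * t * (1 - (t : ℝ) ^ 2) ^ (p + k - 1) := by
  simp [weightB]; ring

theorem integral_mul_one_sub_sq_pow (n : ℕ) (ξ : ℝ) :
    ∫ t in (0 : ℝ)..ξ, t * (1 - t ^ 2) ^ n = (1 - (1 - ξ ^ 2) ^ (n + 1)) / (2 * (n + 1)) := by
  have hn : (n + 1 : ℝ) ≠ 0 := by positivity
  rw [intervalIntegral.integral_eq_sub_of_hasDerivAt
    (f := fun t => -(1 - t ^ 2) ^ (n + 1) / (2 * (n + 1)))]
  · simp; field_simp; ring
  · intro t _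
    have h1 : HasDerivAt (fun t : ℝ => 1 - t ^ 2) (-(2 * t)) t := by
      simpa using (hasDerivAt_pow 2 t).const_sub 1
    have h2 := ((h1.pow (n + 1)).neg).div_const (2 * (n + 1) : ℝ)
    refine h2.congr_deriv ?_
    push_cast
    field_simp
  · exact (by fun_prop : Continuous fun t : ℝ => t * (1 - t ^ 2) ^ n).intervalIntegrable _ _

/-- For `ξ ≠ 0` the integral is elementary and the quotient by `ξ²` is a geometric sum. The
geometric sum also gives the right value at `ξ = 0`, where the average is half the value of the
integrand. -/
theorem avg_weightA (p : ℕ) {k : ℕ} (hk : 1 ≤ k) (F : ℕ → ℝ) (n : ℕ) (ξ : Icc (0 : ℝ) 1) :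
    avg (weightA k * (coeffA p F n • oneSubSq ^ n)) ξ = coeffP p k F n ξ := by
  have hk' : (2 * k + n : ℝ) ≠ 0 := by positivity
  by_cases hξ : (ξ : ℝ) = 0
  · rw [avg_zero _ _ hξ]
    simp only [ContinuousMap.mul_apply, weightA_apply, ContinuousMap.smul_apply,
      ContinuousMap.pow_apply, oneSubSq_apply, coeffP, hξ]
    simp
    field_simp
    ring
  · have h1 := sq_mul_avg (weightA k * (coeffA p F n • oneSubSq ^ n)) ξ
    have h2 : ∫ t in (0 : ℝ)..ξ, t * ext (weightA k * (coeffA p F n • oneSubSq ^ n)) t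
        = ∫ t in (0 : ℝ)..ξ, 4 * k * coeffA p F n * (t * (1 - t ^ 2) ^ (2 * k - 1 + n)) := by
      refine intervalIntegral.integral_congr fun t ht => ?_
      rw [uIcc_of_le ξ.2.1] at ht
      have ht' : t ∈ Icc (0 : ℝ) 1 := ⟨ht.1, ht.2.trans ξ.2.2⟩
      simp only [ext_of_mem _ ht', ContinuousMap.mul_apply, weightA_apply,
        ContinuousMap.smul_apply, ContinuousMap.pow_apply, oneSubSq_apply, smul_eq_mul]
      rw [pow_add]; ring
    have h3 : ((2 * k - 1 + n : ℕ) : ℝ) + 1 = 2 * k + n := by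
      rw [Nat.cast_add, Nat.cast_sub (by omega)]; push_cast; ring
    have h4 : 2 * k - 1 + n + 1 = 2 * k + n := by omega
    rw [h2, intervalIntegral.integral_const_mul, integral_mul_one_sub_sq_pow, h3, h4] at h1
    have hgeom := mul_neg_geom_sum (1 - (ξ : ℝ) ^ 2) (2 * k + n)
    rw [sub_sub_cancel] at hgeom
    rw [coeffP]
    have hξ2 : (ξ : ℝ) ^ 2 ≠ 0 := pow_ne_zero 2 hξ
    refine mul_left_cancel₀ hξ2 ?_
    rw [h1, ← hgeom]
    field_simp
    ring

/-- The recursion of iterated integrals computes the power series solution of the fixed point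
equation `s² = P + δ^p M(B s)`. -/
theorem coeffV_eq {p k : ℕ} (hp : 1 ≤ p) (F : ℕ → ℝ) {s : ℕ → CI}
    (hs0 : ∀ t, 0 < s 0 t)
    (hs : ∀ n, ∑ i ∈ Finset.range (n + 1), s i * s (n - i)
      = avg (weightA k * (coeffA p F n • oneSubSq ^ n)) +
        if p ≤ n then avg (∑ i ∈ Finset.range (n - p + 1),
          s i * (weightB p k * (coeffB p k F (n - p - i) • oneSubSq ^ (n - p - i)))) else 0)
    (hk : 1 ≤ k) (n : ℕ) (ξ : Icc (0 : ℝ) 1) :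
    coeffP p k F n ξ + coeffV p k F n ξ = ∑ i ∈ Finset.range (n + 1), s i ξ * s (n - i) ξ := by
  induction n using Nat.strong_induction_on generalizing ξ with
  | _ n ih =>
    have hev := congrArg (fun ψ : CI => ψ ξ) (hs n)
    simp only [ContinuousMap.sum_apply, ContinuousMap.mul_apply, ContinuousMap.add_apply] at hev
    rw [hev, avg_weightA p hk, coeffV, add_right_inj]
    by_cases hn : n < p
    · simp [hn, not_le.2 hn]
    rw [if_neg hn, if_pos (not_lt.1 hn)]
    set Q : CI := ∑ i ∈ Finset.range (n - p + 1),
          s i * (weightB p k * (coeffB p k F (n - p - i) • oneSubSq ^ (n - p - i))) with hQ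
    have hQt : ∀ t : Icc (0 : ℝ) 1, Q t = ∑ i ∈ Finset.range (n - p + 1), s i t *
        (2 * t * (1 - (t : ℝ) ^ 2) ^ (p + k - 1) *
          (coeffB p k F (n - p - i) * (1 - (t : ℝ) ^ 2) ^ (n - p - i))) := by
      intro t
      simp only [hQ, ContinuousMap.sum_apply, ContinuousMap.mul_apply, weightB_apply,
        ContinuousMap.smul_apply, ContinuousMap.pow_apply, oneSubSq_apply, smul_eq_mul]
    -- At `ξ = 0` the convention `0⁻¹ = 0` makes `coeffV` vanish; this is the correct value, since
    -- the weight in `Q` has a factor `t`.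
    by_cases hξ : (ξ : ℝ) = 0
    · rw [avg_zero _ _ hξ, hQt]
      simp [hξ]
    have hint : ∫ t in (0 : ℝ)..ξ, t * ext Q t = 2 * ∫ t in (0 : ℝ)..ξ,
        t ^ 2 * (1 - t ^ 2) ^ (p + k - 1) *
        coeffR p k F (fun m => if _h : m < n then coeffV p k F m t else 0) t (n - p) := by
      rw [← intervalIntegral.integral_const_mul]
      refine intervalIntegral.integral_congr fun t ht => ?_
      rw [uIcc_of_le ξ.2.1] at ht
      have ht' : t ∈ Icc (0 : ℝ) 1 := ⟨ht.1, ht.2.trans ξ.2.2⟩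
      simp only [ext_of_mem _ ht', hQt, coeffR, Finset.mul_sum]
      refine Finset.sum_congr rfl fun i hi => ?_
      have hi := Finset.mem_range.1 hi
      -- Here `i ≤ n - p < n` because `p ≥ 1`, so the cut-off `m < n` is inactive and the induction
      -- hypothesis identifies the series under the root with the Cauchy square of `s`.
      have hsq : sqrtCoeff (fun m => coeffP p k F m t +
          if _h : m < n then coeffV p k F m t else 0) i = s i ⟨t, ht'⟩ := by
        rw [← sqrtCoeff_sq (s := fun j => s j ⟨t, ht'⟩) (hs0 _) i]
        refine sqrtCoeff_congr i fun m hm => ?_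
        have hmn : m < n := by omega
        rw [dif_pos hmn]
        exact ih m hmn ⟨t, ht'⟩
      rw [hsq]
      ring
    have hξ2 : (ξ : ℝ) ^ 2 ≠ 0 := pow_ne_zero 2 hξ
    refine mul_left_cancel₀ hξ2 ?_
    rw [sq_mul_avg, hint]
    field_simp

end NilpotentReturn

/-! ### The fixed point equation in `C[0,1]` and the model quadrant -/

namespace NilpotentReturn

open Filter Topology Set

open scoped ContDiff in
/-- The analytic solution of `s² = α(δ) + δ^p M(s β(δ))`. -/
theorem exists_sqrt_solution {p : ℕ} (hp : 1 ≤ p) {α β : ℝ → CI} (hα : AnalyticAt ℝ α 0)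
    (hβ : AnalyticAt ℝ β 0) (h0 : ∀ t, 0 < α 0 t) :
    ∃ s : ℝ → CI, AnalyticAt ℝ s 0 ∧ (∀ t, s 0 t = √(α 0 t)) ∧
      ∀ᶠ δ in 𝓝 (0 : ℝ), s δ * s δ = α δ + δ ^ p • avg (s δ * β δ) := by
  let s₀ : CI := ⟨fun t => √(α 0 t), by fun_prop⟩
  have hs₀ : ∀ t, 0 < s₀ t := fun t => Real.sqrt_pos.2 (h0 t)
  have hs₀sq : s₀ * s₀ = α 0 := by
    ext t; exact Real.mul_self_sqrt (h0 t).le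
  let i₀ : CI := ⟨fun t => (2 * s₀ t)⁻¹, by
    have : ∀ t, 2 * s₀ t ≠ 0 := fun t => by have := hs₀ t; positivity
    fun_prop (disch := exact this _)⟩
  let Φ : ℝ × CI → CI := fun q => q.2 * q.2 - α q.1 - q.1 ^ p • avg (q.2 * β q.1)
  have hΦ : ContDiffAt ℝ ω Φ (0, s₀) := by
    have h1 : ContDiffAt ℝ ω (fun q : ℝ × CI => α q.1) (0, s₀) :=
      ContDiffAt.comp (g := α) (0, s₀) hα.contDiffAt contDiffAt_fst
    have h2 : ContDiffAt ℝ ω (fun q : ℝ × CI => β q.1) (0, s₀) :=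
      ContDiffAt.comp (g := β) (0, s₀) hβ.contDiffAt contDiffAt_fst
    have h3 : ContDiffAt ℝ ω (fun q : ℝ × CI => avg (q.2 * β q.1)) (0, s₀) :=
      avg.contDiff.contDiffAt.comp (0, s₀) (contDiffAt_snd.mul h2)
    exact ((contDiffAt_snd.mul contDiffAt_snd).sub h1).sub ((contDiffAt_fst.pow p).smul h3)
  have hp0 : p ≠ 0 := by omega
  -- At `δ = 0` the averaged term disappears as `p ≥ 1`, so the partial derivative is multiplication
  -- by `2 s₀`; its inverse is multiplication by `i₀`, which is continuous because `s₀ > 0`.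
  have hinv : (fderiv ℝ Φ (0, s₀) ∘L .inr ℝ ℝ CI).IsInvertible := by
    have h1 : HasFDerivAt (fun t : CI => Φ (0, t)) (fderiv ℝ Φ (0, s₀) ∘L .inr ℝ ℝ CI) s₀ := by
      have := (hΦ.differentiableAt (by simp)).hasFDerivAt
      exact this.comp s₀ (hasFDerivAt_prodMk_right (0 : ℝ) s₀)
    have h2 : HasFDerivAt (fun t : CI => Φ (0, t))
        (ContinuousLinearMap.mul ℝ CI ((2 : ℝ) • s₀)) s₀ := by
      have h3 : (fun t : CI => Φ (0, t)) = fun t => t * t - α 0 := by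
        funext t; simp [Φ, hp0]
      rw [h3]
      refine (((hasFDerivAt_id s₀).mul (hasFDerivAt_id s₀)).sub_const (α 0)).congr_fderiv ?_
      ext t x
      simp
      ring
    rw [h1.unique h2]
    refine ⟨ContinuousLinearEquiv.equivOfInverse (ContinuousLinearMap.mul ℝ CI ((2 : ℝ) • s₀))
      (ContinuousLinearMap.mul ℝ CI i₀) ?_ ?_, rfl⟩
    · intro t; ext x
      have := (hs₀ x).ne'
      simp [i₀]
      field_simp
    · intro t; ext x
      have := (hs₀ x).ne'
      simp [i₀]
      field_simp
  refine ⟨hΦ.implicitFunction (by simp) hinv,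
    (hΦ.contDiffAt_implicitFunction (by simp) hinv).analyticAt, fun t => ?_, ?_⟩
  · have : hΦ.implicitFunction (by simp) hinv 0 = s₀ :=
      hΦ.implicitFunction_apply_self (by simp) hinv
    rw [this]
    rfl
  · filter_upwards [hΦ.eventually_apply_implicitFunction (by simp) hinv] with δ hδ
    have h1 : Φ (0, s₀) = 0 := by simp [Φ, hp0, hs₀sq]
    rw [h1] at hδ
    simp only [Φ] at hδ
    rw [sub_sub, sub_eq_zero] at hδ
    exact hδ

/-- The orbits in a quadrant: `y = δ^k ξ S(ξ)` along `z = δ (1 - ξ²)`. -/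
theorem exists_quarter {p k : ℕ} (hp : 1 ≤ p) (hk : 1 ≤ k) {F : ℕ → ℝ} {A B : ℝ → ℝ}
    (hA : HasSer A (coeffA p F)) (hB : HasSer B (coeffB p k F)) :
    ∃ D : ℝ → ℝ, HasSer D (coeffD p k F) ∧ ∃ (S : ℝ → ℝ → ℝ) (C : ℝ),
      ∀ᶠ δ in 𝓝 (0 : ℝ), Continuous (S δ) ∧ (∀ ξ, 1 / 2 ≤ S δ ξ ∧ S δ ξ ≤ C) ∧
        S δ 1 ^ 2 = D δ ∧ ∀ ξ ∈ Icc (0 : ℝ) 1, HasDerivWithinAt (fun ξ => ξ * S δ ξ)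
          ((4 * k * (1 - ξ ^ 2) ^ (2 * k - 1) * A (δ * (1 - ξ ^ 2)) +
            δ ^ p * (S δ ξ * (2 * ξ * (1 - ξ ^ 2) ^ (p + k - 1) * B (δ * (1 - ξ ^ 2)))))
              / (2 * S δ ξ)) (Icc 0 1) ξ := by
  obtain ⟨ΦA, hΦA, hΦA'⟩ := exists_dilation hA
  obtain ⟨ΦB, hΦB, hΦB'⟩ := exists_dilation hB
  have hα : HasSer (fun δ => avg (weightA k * ΦA δ))
      (fun n => avg (weightA k * (coeffA p F n • oneSubSq ^ n))) :=
    (hΦA.clm (ContinuousLinearMap.mul ℝ CI (weightA k))).clm avg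
  have hβ : HasSer (fun δ => weightB p k * ΦB δ)
      (fun n => weightB p k * (coeffB p k F n • oneSubSq ^ n)) :=
    hΦB.clm (ContinuousLinearMap.mul ℝ CI (weightB p k))
  have hα0 : ∀ t, 1 ≤ avg (weightA k * ΦA 0) t := fun t => by
    rw [hα.apply_zero, avg_weightA p hk]
    exact one_le_coeffP hp hk F t
  obtain ⟨s, hsa, hs0, hs⟩ := exists_sqrt_solution hp hα.analyticAt hβ.analyticAt
    fun t => zero_lt_one.trans_le (hα0 t)
  have hs0' : ∀ t, 1 ≤ s 0 t := fun t => by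
    rw [hs0]; exact Real.one_le_sqrt.2 (hα0 t)
  obtain ⟨σ, hσ⟩ := exists_hasSer hsa
  have hrec := (((hσ.mul hσ).congr hs).unique
    (hα.add (((hσ.mul hβ).clm avg).pow_smul p)))
  have hσ0 : ∀ t, 0 < σ 0 t := fun t => by
    rw [← hσ.apply_zero]; exact zero_lt_one.trans_le (hs0' t)
  let one : Icc (0 : ℝ) 1 := ⟨1, by norm_num, le_rfl⟩
  refine ⟨fun δ => (s δ * s δ) one, ?_, fun δ => ext (s δ), ‖s 0‖ + 1 / 2, ?_⟩
  · refine ((hσ.mul hσ).clm (ContinuousMap.evalCLM ℝ one)).congr_coeff fun n => ?_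
    have := coeffV_eq hp F hσ0 (fun n => congrFun hrec n) hk n one
    rw [coeffD]
    simpa [ContinuousMap.sum_apply] using this.symm
  -- As `s 0 ≥ 1`, closeness in sup norm gives both the lower bound `1/2` and the upper bound `C`,
  -- uniformly in `ξ`.
  have hnear : ∀ᶠ δ in 𝓝 (0 : ℝ), ‖s δ - s 0‖ < 1 / 2 := by
    have := hsa.continuousAt.eventually (Metric.ball_mem_nhds (s 0) (by norm_num : (0 : ℝ) < 1 / 2))
    simpa [dist_eq_norm] using this
  filter_upwards [hs, hΦA', hΦB', hnear] with δ h1 h2 h3 h4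
  have hbd : ∀ t, 1 / 2 ≤ s δ t ∧ s δ t ≤ ‖s 0‖ + 1 / 2 := fun t => by
    have h5 := ((s δ - s 0).norm_coe_le_norm t).trans h4.le
    rw [ContinuousMap.sub_apply, Real.norm_eq_abs, abs_le] at h5
    have h6 := (le_abs_self _).trans ((s 0).norm_coe_le_norm t)
    have h7 := hs0' t
    constructor <;> linarith [h5.1, h5.2]
  refine ⟨continuous_ext _, fun ξ => hbd _, ?_, ?_⟩
  · rw [ext_of_mem _ one.2, sq]; rfl
  -- the differential equation
  set Q : CI := weightA k * ΦA δ + δ ^ p • (s δ * (weightB p k * ΦB δ)) with hQ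
  have hQt : ∀ ξ (h : ξ ∈ Icc (0 : ℝ) 1), Q ⟨ξ, h⟩ = 4 * k * (1 - ξ ^ 2) ^ (2 * k - 1) *
      A (δ * (1 - ξ ^ 2)) + δ ^ p * (ext (s δ) ξ *
        (2 * ξ * (1 - ξ ^ 2) ^ (p + k - 1) * B (δ * (1 - ξ ^ 2)))) := by
    intro ξ h
    simp only [hQ, ContinuousMap.add_apply, ContinuousMap.mul_apply, ContinuousMap.smul_apply,
      weightA_apply, weightB_apply, h2, h3, smul_eq_mul, ext_of_mem _ h]
  have hsq : s δ * s δ = avg Q := by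
    rw [h1, hQ, map_add, map_smul]
  intro ξ hξ
  rw [← hQt ξ hξ]
  have hSξ : 0 < ext (s δ) ξ := lt_of_lt_of_le (by norm_num) (hbd _).1
  rcases eq_or_lt_of_le hξ.1 with h0 | h0
  · subst h0
    -- At `ξ = 0` the average is half the value, so the fixed point equation reads `S(0)² = Q(0)/2`.
    -- Hence `Q/(2S) = S(0)`, which is the slope of `ξ S(ξ)` at `0` by mere continuity of `S`.
    have h5 : ext (s δ) 0 ^ 2 = Q ⟨0, hξ⟩ / 2 := by
      rw [← avg_zero Q ⟨0, hξ⟩ rfl, ← hsq, ext_of_mem _ hξ, sq]; rfl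
    have h6 : Q ⟨0, hξ⟩ / (2 * ext (s δ) 0) = ext (s δ) 0 := by
      rw [div_eq_iff (by positivity)]; linarith
    rw [h6]
    have : HasDerivAt (fun ξ => ξ * ext (s δ) ξ) (ext (s δ) 0) 0 := by
      rw [hasDerivAt_iff_tendsto_slope]
      have h7 := ((continuous_ext (s δ)).tendsto 0).mono_left (nhdsWithin_le_nhds (s := {0}ᶜ))
      refine h7.congr' ?_
      filter_upwards [self_mem_nhdsWithin] with x hx
      have hx : x ≠ 0 := hx
      rw [slope_def_field]
      field_simp
      ring
    exact this.hasDerivWithinAt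
  -- Away from `0` the square root is differentiable, and differentiability of `ξ S` is obtained
  -- from the integral although `S` is only known to be continuous.
  · have hU : ∀ x ∈ Icc (0 : ℝ) 1, x * ext (s δ) x = √(∫ t in (0 : ℝ)..x, t * ext Q t) := by
      intro x hx
      have h5 : 0 ≤ x * ext (s δ) x :=
        mul_nonneg hx.1 (le_trans (by norm_num) (hbd _).1)
      rw [← sq_mul_avg Q ⟨x, hx⟩, ← hsq, ContinuousMap.mul_apply, ← ext_of_mem _ hx, ← sq,
        ← mul_pow, Real.sqrt_sq h5]
    have hcont : Continuous fun t => t * ext Q t := continuous_id.mul (continuous_ext Q)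
    have h6 : HasDerivAt (fun x => ∫ t in (0 : ℝ)..x, t * ext Q t) (ξ * ext Q ξ) ξ :=
      intervalIntegral.integral_hasDerivAt_right (hcont.intervalIntegrable _ _)
        (hcont.stronglyMeasurableAtFilter _ _) hcont.continuousAt
    have h7 : √(∫ t in (0 : ℝ)..ξ, t * ext Q t) ≠ 0 := by
      rw [← hU ξ hξ]; positivity
    have h8 := (h6.sqrt (fun h => h7 (by rw [h, Real.sqrt_zero]))).hasDerivWithinAt (s := Icc 0 1)
    refine (h8.congr hU (hU ξ hξ)).congr_deriv ?_
    rw [← hU ξ hξ, ext_of_mem Q hξ]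
    field_simp

end NilpotentReturn

namespace NilpotentReturn

open Filter Topology Set

/-! ### Orbit segments -/

/-- An orbit of `X` runs from `q` to `q'`, through points of `S` in between. -/
def Conn (X : ℝ × ℝ → ℝ × ℝ) (S : Set (ℝ × ℝ)) (q q' : ℝ × ℝ) : Prop :=
  ∃ τ > 0, ∃ γ : ℝ → ℝ × ℝ, γ 0 = q ∧ γ τ = q' ∧ IsIntegralCurveOn γ (fun _ => X) (Icc 0 τ) ∧
    ∀ t ∈ Ioo 0 τ, γ t ∈ S

/-- Off a closed interval, a derivative within it is a vacuous condition; in gluing over a union,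
each piece need only be checked on itself. -/
theorem hasDerivWithinAt_of_mem_imp {E : Type*} [NormedAddCommGroup E] [NormedSpace ℝ E]
    {γ : ℝ → E} {v : E} {a b t : ℝ}
    (h : t ∈ Icc a b → HasDerivWithinAt γ v (Icc a b) t) : HasDerivWithinAt γ v (Icc a b) t := by
  by_cases ht : t ∈ Icc a b
  · exact h ht
  · rw [hasDerivWithinAt_iff_hasFDerivWithinAt]
    exact HasFDerivWithinAt.of_notMem_closure (by rwa [isClosed_Icc.closure_eq])

/-- The field is autonomous, so the second piece may be shifted in time, and both one-sided
derivatives at the junction equal `X q'`. The junction becomes an interior point, hence the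
condition `q' ∈ S`. -/
theorem Conn.trans {X : ℝ × ℝ → ℝ × ℝ} {S : Set (ℝ × ℝ)} {q q' q'' : ℝ × ℝ} (h₁ : Conn X S q q')
    (hq' : q' ∈ S) (h₂ : Conn X S q' q'') : Conn X S q q'' := by
  obtain ⟨τ₁, hτ₁, γ₁, h10, h11, h1d, h1m⟩ := h₁
  obtain ⟨τ₂, hτ₂, γ₂, h20, h21, h2d, h2m⟩ := h₂
  let γ : ℝ → ℝ × ℝ := fun t => if t ≤ τ₁ then γ₁ t else γ₂ (t - τ₁)
  have hγ₁ : ∀ t ∈ Icc 0 τ₁, γ t = γ₁ t := fun t ht => if_pos ht.2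
  have hγ₂ : ∀ t ∈ Icc τ₁ (τ₁ + τ₂), γ t = γ₂ (t - τ₁) := fun t ht => by
    rcases eq_or_lt_of_le ht.1 with h | h
    · subst h; simp [γ, h11, h20]
    · exact if_neg (not_le.2 h)
  refine ⟨τ₁ + τ₂, by positivity, γ, ?_, ?_, ?_, ?_⟩
  · rw [hγ₁ 0 ⟨le_rfl, hτ₁.le⟩, h10]
  · rw [hγ₂ _ ⟨by linarith, le_rfl⟩, add_sub_cancel_left, h21]
  · intro t _
    have hu : Icc 0 (τ₁ + τ₂) = Icc 0 τ₁ ∪ Icc τ₁ (τ₁ + τ₂) :=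
      (Icc_union_Icc_eq_Icc hτ₁.le (by linarith)).symm
    rw [hu]
    refine (hasDerivWithinAt_of_mem_imp fun ht => ?_).union (hasDerivWithinAt_of_mem_imp fun ht => ?_)
    · rw [hγ₁ t ht]
      exact (h1d t ht).congr hγ₁ (hγ₁ t ht)
    · rw [hγ₂ t ht]
      have hmap : MapsTo (fun t => t - τ₁) (Icc τ₁ (τ₁ + τ₂)) (Icc 0 τ₂) := fun x hx =>
        ⟨by linarith [hx.1], by linarith [hx.2]⟩
      have h3 := (h2d (t - τ₁) (hmap ht)).scomp t
        (((hasDerivAt_id t).sub_const τ₁).hasDerivWithinAt) hmap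
      rw [one_smul] at h3
      exact h3.congr hγ₂ (hγ₂ t ht)
  · intro t ht
    rcases lt_trichotomy t τ₁ with h | h | h
    · rw [hγ₁ t ⟨ht.1.le, h.le⟩]; exact h1m t ⟨ht.1, h⟩
    · rw [h, hγ₁ τ₁ ⟨hτ₁.le, le_rfl⟩, h11]; exact hq'
    · rw [hγ₂ t ⟨h.le, ht.2.le⟩]; exact h2m _ ⟨by linarith, by linarith [ht.2]⟩

/-- A curve with velocity a positive multiple of `X` is an orbit segment, up to a change of time. -/
theorem conn_of_param {X : ℝ × ℝ → ℝ × ℝ} {S : Set (ℝ × ℝ)} {c : ℝ → ℝ × ℝ} {ρ : ℝ → ℝ}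
    (hρ : ContinuousOn ρ (Icc 0 1)) (hpos : ∀ ξ ∈ Icc (0 : ℝ) 1, 0 < ρ ξ)
    (hc : ∀ ξ ∈ Icc (0 : ℝ) 1, HasDerivWithinAt c (ρ ξ • X (c ξ)) (Icc 0 1) ξ)
    (hS : ∀ ξ ∈ Ioo (0 : ℝ) 1, c ξ ∈ S) : Conn X S (c 0) (c 1) := by
  -- Extending `ρ` by constants keeps it above its positive minimum `m`. The time function `T` then
  -- grows at least at rate `m`, so it is an order isomorphism of the whole line whose inverse
  -- reparametrizes `c`.
  let ρ' : ℝ → ℝ := IccExtend zero_le_one (fun x : Icc (0 : ℝ) 1 => ρ x)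
  have hρ'c : Continuous ρ' := (continuousOn_iff_continuous_domRestrict.1 hρ).Icc_extend'
  have hρ'eq : ∀ ξ ∈ Icc (0 : ℝ) 1, ρ' ξ = ρ ξ := fun ξ hξ => IccExtend_of_mem _ _ hξ
  obtain ⟨x₀, hx₀, hmin⟩ := isCompact_Icc.exists_isMinOn (nonempty_Icc.2 zero_le_one) hρ
  set m := ρ x₀
  have hm : 0 < m := hpos x₀ hx₀
  have hρ'm : ∀ ξ, m ≤ ρ' ξ := fun ξ => hmin (projIcc 0 1 zero_le_one ξ).2
  let T : ℝ → ℝ := fun x => ∫ t in (0 : ℝ)..x, ρ' t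
  have hT : ∀ x, HasDerivAt T (ρ' x) x := fun x =>
    intervalIntegral.integral_hasDerivAt_right (hρ'c.intervalIntegrable _ _)
      (hρ'c.stronglyMeasurableAtFilter _ _) hρ'c.continuousAt
  have hT0 : T 0 = 0 := intervalIntegral.integral_same
  have hmono : StrictMono T := strictMono_of_hasDerivAt_pos hT fun x => hm.trans_le (hρ'm x)
  have hTm : Monotone fun x => T x - m * x := by
    have : ∀ x, HasDerivAt (fun x => T x - m * x) (ρ' x - m) x := fun x => by
      have h := (hT x).sub ((hasDerivAt_id x).const_mul m)
      rw [mul_one] at h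
      exact h
    exact monotone_of_hasDerivAt_nonneg this fun x => sub_nonneg.2 (hρ'm x)
  have hTcont : Continuous T := continuous_iff_continuousAt.2 fun x => (hT x).continuousAt
  have hsurj : Function.Surjective T := by
    refine hTcont.surjective ?_ ?_
    · refine tendsto_atTop_mono' _ ?_ (tendsto_id.const_mul_atTop hm)
      filter_upwards [eventually_ge_atTop 0] with x hx
      have h := hTm hx
      simp only [hT0, mul_zero, sub_zero] at h
      simp only [id]
      linarith
    · refine tendsto_atBot_mono' _ ?_ (tendsto_id.const_mul_atBot hm)
      filter_upwards [eventually_le_atBot 0] with x hx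
      have h := hTm hx
      simp only [hT0, mul_zero, sub_zero] at h
      simp only [id]
      linarith
  let e : ℝ ≃o ℝ := hmono.orderIsoOfSurjective T hsurj
  have he : ∀ x, e x = T x := fun x => rfl
  have he0 : e.symm 0 = 0 := by rw [OrderIso.symm_apply_eq, he, hT0]
  have he1 : e.symm (T 1) = 1 := by rw [OrderIso.symm_apply_eq, he]
  have hed : ∀ t, HasDerivAt e.symm (ρ' (e.symm t))⁻¹ t := fun t =>
    (hT (e.symm t)).of_local_left_inverse e.symm.continuous.continuousAt
      (hm.trans_le (hρ'm _)).ne' (Eventually.of_forall fun x => e.apply_symm_apply x)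
  have hmaps : MapsTo e.symm (Icc 0 (T 1)) (Icc 0 1) := fun t ht =>
    ⟨by rw [← he0]; exact e.symm.monotone ht.1, by rw [← he1]; exact e.symm.monotone ht.2⟩
  refine ⟨T 1, by rw [← hT0]; exact hmono zero_lt_one, fun t => c (e.symm t), congrArg c he0,
    congrArg c he1, fun t ht => ?_, fun t ht => hS _ ⟨?_, ?_⟩⟩
  · have h1 := (hc _ (hmaps ht)).scomp t (hed t).hasDerivWithinAt hmaps
    rw [← hρ'eq _ (hmaps ht), smul_smul, inv_mul_cancel₀ (hm.trans_le (hρ'm _)).ne',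
      one_smul] at h1
    exact h1
  · rw [← he0]; exact e.symm.strictMono ht.1
  · rw [← he1]; exact e.symm.strictMono ht.2

theorem conn_of_param_neg {X : ℝ × ℝ → ℝ × ℝ} {S : Set (ℝ × ℝ)} {c : ℝ → ℝ × ℝ} {ρ : ℝ → ℝ}
    (hρ : ContinuousOn ρ (Icc 0 1)) (hpos : ∀ ξ ∈ Icc (0 : ℝ) 1, 0 < ρ ξ)
    (hc : ∀ ξ ∈ Icc (0 : ℝ) 1, HasDerivWithinAt c (-(ρ ξ • X (c ξ))) (Icc 0 1) ξ)
    (hS : ∀ ξ ∈ Ioo (0 : ℝ) 1, c ξ ∈ S) : Conn X S (c 1) (c 0) := by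
  have hmaps : MapsTo (fun ξ : ℝ => 1 - ξ) (Icc 0 1) (Icc 0 1) := fun ξ hξ =>
    ⟨by linarith [hξ.2], by linarith [hξ.1]⟩
  have h := conn_of_param (X := X) (S := S) (c := fun ξ => c (1 - ξ)) (ρ := fun ξ => ρ (1 - ξ))
    (hρ.comp (by fun_prop) hmaps) (fun ξ hξ => hpos _ (hmaps hξ)) (fun ξ hξ => ?_)
    (fun ξ hξ => hS _ ⟨by linarith [hξ.2], by linarith [hξ.1]⟩)
  · simpa using h
  · have h1 := (hc _ (hmaps hξ)).scomp ξ
      (((hasDerivAt_id ξ).const_sub 1).hasDerivWithinAt) hmaps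
    rw [neg_smul, one_smul, neg_neg] at h1
    exact h1

/-- Orbit segments of a Lipschitz field give first returns. -/
theorem Conn.isFirstReturn {X : ℝ × ℝ → ℝ × ℝ} {U T : Set (ℝ × ℝ)} {q q' : ℝ × ℝ} {K : NNReal}
    (h : Conn X (U \ T) q q') (hX : LipschitzOnWith K X U) (hq : q ∈ U) (hq' : q' ∈ U)
    (hT : q' ∈ T) : IsFirstReturn X U T q q' := by
  obtain ⟨τ, hτ, γ, h0, h1, hd, hm⟩ := h
  have hU : ∀ t ∈ Icc 0 τ, γ t ∈ U := by
    intro t ht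
    rcases eq_or_lt_of_le ht.1 with h | h
    · rw [← h, h0]; exact hq
    rcases eq_or_lt_of_le ht.2 with h' | h'
    · rw [h', h1]; exact hq'
    exact (hm t ⟨h, h'⟩).1
  refine ⟨τ, hτ, γ, ⟨h0, hd, hU⟩, ?_, h1, hT, fun t ht => (hm t ht).2⟩
  intro τ' γ' hγ'
  have hsub : Icc 0 (min τ τ') ⊆ Icc 0 τ := Icc_subset_Icc_right (min_le_left _ _)
  have hsub' : Icc 0 (min τ τ') ⊆ Icc 0 τ' := Icc_subset_Icc_right (min_le_right _ _)
  have hder : ∀ {σ : ℝ} {δ : ℝ → ℝ × ℝ}, IsIntegralCurveOn δ (fun _ => X) (Icc 0 σ) →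
      min τ τ' ≤ σ → ∀ t ∈ Ico 0 (min τ τ'), HasDerivWithinAt δ (X (δ t)) (Ici t) t := by
    intro σ δ hδ hσ t ht
    have h2 := hδ t ⟨ht.1, ht.2.le.trans hσ⟩
    refine (h2.mono (Icc_subset_Icc_left ht.1)).mono_of_mem_nhdsWithin ?_
    exact Icc_mem_nhdsGE (ht.2.trans_le hσ)
  exact ODE_solution_unique_of_mem_Icc_right (v := fun _ => X) (s := fun _ => U) (K := K)
    (fun _ _ => hX) (hγ'.hasDeriv.continuousOn.mono hsub')
    (hder hγ'.hasDeriv (min_le_right _ _)) (fun t ht => hγ'.mem t (hsub' (Ico_subset_Icc_self ht)))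
    (hd.continuousOn.mono hsub) (hder hd (min_le_left _ _))
    (fun t ht => hU t (hsub (Ico_subset_Icc_self ht))) (by rw [hγ'.init, h0])

/-! ### Taylor coefficients of `A` and `B` -/

theorem HasSer.deriv {f : ℝ → ℝ} {a : ℕ → ℝ} (h : HasSer f a) :
    HasSer (deriv f) (fun n => (n + 1) * a (n + 1)) := by
  have h1 := hasSer_taylor h.analyticAt.deriv
  have h2 := (hasSer_taylor h.analyticAt).unique h
  refine h1.congr_coeff fun n => ?_
  rw [← iteratedDeriv_succ', ← congrFun h2 (n + 1), Nat.factorial_succ]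
  have := Nat.factorial_ne_zero n
  push_cast
  field_simp

theorem HasSer.comp_mul {f : ℝ → ℝ} {a : ℕ → ℝ} (h : HasSer f a) (σ : ℝ) :
    HasSer (fun x => f (σ * x)) (fun n => σ ^ n * a n) := by
  have : Tendsto (fun x : ℝ => σ * x) (𝓝 0) (𝓝 0) := by
    have hc : Continuous fun x : ℝ => σ * x := by fun_prop
    simpa using hc.tendsto 0
  filter_upwards [this.eventually h] with x hx
  refine hx.congr_terms fun n => ?_
  simp [mul_pow]; ring

theorem HasSer.const_mul {f : ℝ → ℝ} {a : ℕ → ℝ} (h : HasSer f a) (c : ℝ) :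
    HasSer (fun x => c * f x) (fun n => c * a n) :=
  h.clm (ContinuousLinearMap.mul ℝ ℝ c)

theorem hasSer_coeffA {φ : ℝ → ℝ} {F : ℕ → ℝ} (h : HasSer φ F) (p : ℕ) :
    HasSer (fun x => 1 + x ^ (2 * p) * (φ x * φ x)) (coeffA p F) := by
  refine HasSer.congr_coeff (HasSer.add (hasPS_C 1) ((h.mul h).pow_smul (2 * p))) fun n => ?_
  simp [coeffA]

theorem hasSer_coeffB {φ : ℝ → ℝ} {F : ℕ → ℝ} (h : HasSer φ F) (p k : ℕ) :
    HasSer (fun x => 2 * (x * deriv φ x) + 2 * (p + 2 * k) * φ x) (coeffB p k F) := by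
  have h1 := (h.deriv.pow_smul 1).const_mul 2
  refine HasSer.congr_coeff ((h1.congr ?_).add (h.const_mul (2 * (p + 2 * k)))) fun n => ?_
  · exact Eventually.of_forall fun x => by simp
  · cases n with
    | zero => simp [coeffB]
    | succ n => simp [coeffB]; ring

end NilpotentReturn

/-! ### Orbits of the planar system in each quadrant -/

namespace NilpotentReturn

open Filter Topology Set

theorem sq_eq_one_of_sign {s : ℝ} (h : s = 1 ∨ s = -1) : s ^ 2 = 1 := by
  rcases h with rfl | rfl <;> norm_num

theorem pow_sq_eq_one_of_sign {s : ℝ} (h : s = 1 ∨ s = -1) (n : ℕ) : (s ^ n) ^ 2 = 1 := by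
  rw [← pow_mul, mul_comm, pow_mul, sq_eq_one_of_sign h, one_pow]

/-- The identity behind the normal form `ẏ = k z^(2k-1) A(z) + z^l B(z) y / 2`. -/
theorem normal_form_identity {k p l : ℕ} (hk : 1 ≤ k) (hl : p + k = l + 1) {δ ξ u S G G' : ℝ}
    (hδ : δ ≠ 0) (hS : S ≠ 0) :
    2 * k * δ / (δ ^ k * S) * ((δ * u) ^ (2 * k - 1)
        + (δ * u) ^ l * G * ((δ * u) ^ (l + 1) * G + δ ^ k * (ξ * S)))
      = ((l + 1) * (δ * u) ^ l * G + (δ * u) ^ (l + 1) * G') * (-(2 * δ * ξ))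
        + δ ^ k * ((4 * k * u ^ (2 * k - 1) * (1 + (δ * u) ^ (2 * p) * (G * G))
          + δ ^ p * (S * (2 * ξ * u ^ (p + k - 1)
            * (2 * (δ * u * G') + 2 * (p + 2 * k) * G)))) / (2 * S)) := by
  obtain ⟨m, rfl⟩ : ∃ m, k = m + 1 := ⟨k - 1, by omega⟩
  obtain rfl : l = p + m := by omega
  have e1 : 2 * (m + 1) - 1 = 2 * m + 1 := by omega
  have e2 : p + (m + 1) - 1 = p + m := by omega
  rw [e1, e2]
  have hδm : δ ^ m ≠ 0 := pow_ne_zero m hδ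
  simp only [mul_pow, pow_add, pow_mul, pow_one]
  push_cast
  field_simp
  ring

/-- Orbits in the quadrant `σ z > 0`, `s κ y > 0`, where `y = w - z^(l+1) g(z) / f(z)`. -/
theorem exists_quarter_orbit {k l p : ℕ} (hk : 1 ≤ k) (hp : 1 ≤ p) (hl : p + k = l + 1)
    {f g : ℝ → ℝ} (hf : AnalyticAt ℝ f 0) {s : ℝ} (hs : s = 1 ∨ s = -1)
    (hsf : 0 < s * f 0) {σ κ : ℝ} (hσ : σ = 1 ∨ σ = -1) (hκ : κ = 1 ∨ κ = -1) {a : ℕ → ℝ}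
    (ha : HasSer (fun z => g z / f z) a) :
    ∃ D : ℝ → ℝ, HasSer D (coeffD p k fun n => s * κ * σ ^ (p + k) * (σ ^ n * a n)) ∧
      ∀ r > 0, ∀ᶠ δ in 𝓝[>] (0 : ℝ), ∃ y > 0, y ^ 2 = δ ^ (2 * k) * D δ ∧
        (0, s * κ * y) ∈ Metric.ball (0 : ℝ × ℝ) r \ arc l f g r ∧
        (σ * δ, (σ * δ) ^ (l + 1) * g (σ * δ) / f (σ * δ)) ∈ Metric.ball (0 : ℝ × ℝ) r ∧
        (σ * κ = 1 → Conn (field k l f g) (Metric.ball 0 r \ arc l f g r)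
          (σ * δ, (σ * δ) ^ (l + 1) * g (σ * δ) / f (σ * δ)) (0, s * κ * y)) ∧
        (σ * κ = -1 → Conn (field k l f g) (Metric.ball 0 r \ arc l f g r)
          (0, s * κ * y) (σ * δ, (σ * δ) ^ (l + 1) * g (σ * δ) / f (σ * δ))) := by
  -- Under `z ↦ σ z`, `y ↦ s κ y` the normal form keeps its shape with `F` replaced by `c F(σ z)`,
  -- and time is reversed when `σ κ = -1`.
  obtain ⟨c, hc⟩ : ∃ c, c = s * κ * σ ^ (p + k) := ⟨_, rfl⟩
  rw [← hc]
  have hs2 := sq_eq_one_of_sign hs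
  have hκ2 := sq_eq_one_of_sign hκ
  have hσ2 := sq_eq_one_of_sign hσ
  let G : ℝ → ℝ := fun z => c * (g (σ * z) / f (σ * z))
  have hG : HasSer G (fun n => c * (σ ^ n * a n)) := (ha.comp_mul σ).const_mul c
  obtain ⟨D, hD, S, C, hS⟩ := exists_quarter hp hk (hasSer_coeffA hG p) (hasSer_coeffB hG p k)
  refine ⟨D, hD, fun r hr => ?_⟩
  -- a neighbourhood of the origin
  have hfσ : ContinuousAt (fun z => f (σ * z)) 0 := by
    have h1 : ContinuousAt f (σ * 0) := by simpa using hf.continuousAt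
    exact h1.comp (f := fun z => σ * z) (by fun_prop)
  have hGc : ContinuousAt (fun z => z ^ (l + 1) * G z) 0 :=
    (continuousAt_id.pow _).mul hG.analyticAt.continuousAt
  have hloc : ∀ᶠ z in 𝓝 (0 : ℝ), 0 < s * f (σ * z) ∧ ContinuousAt (fun z => f (σ * z)) z ∧
      AnalyticAt ℝ G z ∧ |z ^ (l + 1) * G z| < r / 2 := by
    have hfσa : AnalyticAt ℝ (fun z => f (σ * z)) 0 := by
      have h1 : AnalyticAt ℝ f (σ * 0) := by simpa using hf
      exact h1.comp (f := fun z => σ * z) (by fun_prop)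
    have h1 : ∀ᶠ z in 𝓝 (0 : ℝ), 0 < s * f (σ * z) :=
      (continuousAt_const.mul hfσ).eventually (lt_mem_nhds (by simpa using hsf))
    have h2 : ∀ᶠ z in 𝓝 (0 : ℝ), |z ^ (l + 1) * G z| < r / 2 :=
      hGc.abs.eventually (gt_mem_nhds (by simpa using hr))
    filter_upwards [h1, h2, hfσa.eventually_analyticAt, hG.analyticAt.eventually_analyticAt]
      with z h3 h4 h5 h6
    exact ⟨h3, h5.continuousAt, h6, h4⟩
  obtain ⟨R, hR, hloc⟩ := Metric.eventually_nhds_iff.1 hloc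
  have hsmall : ∀ᶠ δ in 𝓝[>] (0 : ℝ), 0 < δ ∧ δ < R ∧ δ < r ∧ δ ≤ 1 ∧ δ * C < r / 2 := by
    have h1 : ∀ᶠ δ in 𝓝 (0 : ℝ), δ * C < r / 2 := by
      have : ContinuousAt (fun δ : ℝ => δ * C) 0 := by fun_prop
      exact this.eventually (gt_mem_nhds (by simpa using hr))
    filter_upwards [self_mem_nhdsWithin, nhdsWithin_le_nhds (gt_mem_nhds hR),
      nhdsWithin_le_nhds (gt_mem_nhds hr), nhdsWithin_le_nhds (gt_mem_nhds one_pos),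
      nhdsWithin_le_nhds h1] with δ h2 h3 h4 h5 h6
    exact ⟨h2, h3, h4, h5.le, h6⟩
  filter_upwards [hsmall, nhdsWithin_le_nhds hS] with δ ⟨hδ, hδR, hδr, hδ1, hδC⟩
    ⟨hScont, hSb, hS1, hSd⟩
  have hSpos : ∀ ξ, 0 < S δ ξ := fun ξ => lt_of_lt_of_le (by norm_num) (hSb ξ).1
  have hu : ∀ ξ ∈ Icc (0 : ℝ) 1, 0 ≤ δ * (1 - ξ ^ 2) ∧ δ * (1 - ξ ^ 2) ≤ δ := fun ξ hξ => by
    have h1 : ξ ^ 2 ≤ 1 := pow_le_one₀ hξ.1 hξ.2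
    exact ⟨mul_nonneg hδ.le (by linarith), mul_le_of_le_one_right hδ.le (by nlinarith)⟩
  have hlocξ : ∀ ξ ∈ Icc (0 : ℝ) 1, _ := fun ξ hξ => hloc (y := δ * (1 - ξ ^ 2)) (by
    rw [dist_zero_right, Real.norm_of_nonneg (hu ξ hξ).1]
    exact (hu ξ hξ).2.trans_lt hδR)
  let curve : ℝ → ℝ × ℝ := fun ξ => (σ * (δ * (1 - ξ ^ 2)),
    s * κ * ((δ * (1 - ξ ^ 2)) ^ (l + 1) * G (δ * (1 - ξ ^ 2)) + δ ^ k * (ξ * S δ ξ)))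
  have hG' : ∀ z, f (σ * z) ≠ 0 →
      f (σ * z) * (s * κ * (z ^ (l + 1) * G z)) = (σ * z) ^ (l + 1) * g (σ * z) := by
    intro z hz
    have h1 : s * κ * c = σ ^ (l + 1) := by
      rw [hc, hl]; linear_combination σ ^ (l + 1) * (κ ^ 2 * hs2 + hκ2)
    simp only [G]
    field_simp
    rw [mul_pow, ← h1]; ring
  have hfne : ∀ ξ ∈ Icc (0 : ℝ) 1, f (σ * (δ * (1 - ξ ^ 2))) ≠ 0 := fun ξ hξ h => by
    have := (hlocξ ξ hξ).1
    rw [h] at this; simp at this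
  have hs0 : s ≠ 0 := fun h => by simp [h] at hs2
  have hκ0 : κ ≠ 0 := fun h => by simp [h] at hκ2
  have hσ0 : σ ≠ 0 := fun h => by simp [h] at hσ2
  have habs : ∀ {x : ℝ}, x ^ 2 = 1 → |x| = 1 := fun {x} hx => by
    rw [← Real.sqrt_sq_eq_abs, hx, Real.sqrt_one]
  have hcurve0 : curve 0 = (σ * δ, (σ * δ) ^ (l + 1) * g (σ * δ) / f (σ * δ)) := by
    have h1 := hfne 0 ⟨le_rfl, zero_le_one⟩
    have h2 := hG' δ (by simpa using h1)
    refine Prod.ext (by simp [curve]) ?_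
    simp only [curve]
    rw [eq_div_iff (by simpa using h1), ← h2]
    simp
    ring
  have hcurve1 : curve 1 = (0, s * κ * (δ ^ k * S δ 1)) := by
    refine Prod.ext (by simp [curve]) ?_
    simp [curve]
  have hball : ∀ ξ ∈ Icc (0 : ℝ) 1, curve ξ ∈ Metric.ball (0 : ℝ × ℝ) r := by
    intro ξ hξ
    rw [mem_ball_zero_iff, Prod.norm_def, max_lt_iff]
    constructor
    · simp only [curve, Real.norm_eq_abs]
      rw [abs_mul, habs hσ2, one_mul, abs_of_nonneg (hu ξ hξ).1]
      exact (hu ξ hξ).2.trans_lt hδr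
    · simp only [curve, Real.norm_eq_abs]
      rw [abs_mul, abs_mul, habs hs2, habs hκ2, one_mul, one_mul]
      have h1 : δ ^ k * (ξ * S δ ξ) ≤ δ * C := by
        have h2 : δ ^ k ≤ δ := by simpa using pow_le_pow_of_le_one hδ.le hδ1 hk
        have h3 : ξ * S δ ξ ≤ 1 * C := mul_le_mul hξ.2 (hSb ξ).2 (hSpos ξ).le zero_le_one
        rw [one_mul] at h3
        exact mul_le_mul h2 h3 (mul_nonneg hξ.1 (hSpos ξ).le) hδ.le
      have h2 : 0 ≤ δ ^ k * (ξ * S δ ξ) :=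
        mul_nonneg (by positivity) (mul_nonneg hξ.1 (hSpos ξ).le)
      have h3 := (hlocξ ξ hξ).2.2.2
      rw [abs_lt] at h3 ⊢
      constructor <;> linarith [h3.1, h3.2]
  -- Meeting the arc would force `y = 0`, that is `δ^k ξ S = 0`, which is impossible for `ξ > 0`.
  have hmem : ∀ ξ ∈ Ioc (0 : ℝ) 1, curve ξ ∈ Metric.ball (0 : ℝ × ℝ) r \ arc l f g r := by
    intro ξ hξ
    have hξ' : ξ ∈ Icc (0 : ℝ) 1 := ⟨hξ.1.le, hξ.2⟩
    refine ⟨hball ξ hξ', fun h => ?_⟩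
    have h1 := h.2.2
    simp only [curve] at h1
    rw [← hG' _ (hfne ξ hξ'), mul_right_inj' (hfne ξ hξ'), mul_right_inj' (mul_ne_zero hs0 hκ0)]
      at h1
    have h2 : 0 < δ ^ k * (ξ * S δ ξ) :=
      mul_pos (by positivity) (mul_pos hξ.1 (hSpos ξ))
    linarith
  -- velocity
  let ρ : ℝ → ℝ := fun ξ => 2 * δ / (s * f (σ * (δ * (1 - ξ ^ 2))) * (δ ^ k * S δ ξ))
  have hρpos : ∀ ξ ∈ Icc (0 : ℝ) 1, 0 < ρ ξ := fun ξ hξ => by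
    have h1 := (hlocξ ξ hξ).1
    have h2 := hSpos ξ
    positivity
  have hρc : ContinuousOn ρ (Icc 0 1) := by
    intro ξ hξ
    have h1 := (hlocξ ξ hξ).1
    have h2 := hSpos ξ
    refine ContinuousAt.continuousWithinAt (continuousAt_const.div ?_ (by positivity))
    have h3 : ContinuousAt (fun ξ => f (σ * (δ * (1 - ξ ^ 2)))) ξ :=
      ContinuousAt.comp (g := fun z => f (σ * z)) (f := fun ξ => δ * (1 - ξ ^ 2))
        (hlocξ ξ hξ).2.1 (by fun_prop)
    exact (continuousAt_const.mul h3).mul (continuousAt_const.mul hScont.continuousAt)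
  have hvel : ∀ ξ ∈ Icc (0 : ℝ) 1,
      HasDerivWithinAt curve ((σ * κ) • ρ ξ • field k l f g (curve ξ)) (Icc 0 1) ξ := by
    intro ξ hξ
    obtain ⟨hf1, -, hGa, -⟩ := hlocξ ξ hξ
    have hu' : HasDerivAt (fun ξ : ℝ => δ * (1 - ξ ^ 2)) (-(2 * δ * ξ)) ξ := by
      refine (((hasDerivAt_pow 2 ξ).const_sub 1).const_mul δ).congr_deriv ?_
      simp; ring
    have hGd := hGa.differentiableAt.hasDerivAt
    have hGu := ((hasDerivAt_pow (l + 1) (δ * (1 - ξ ^ 2))).mul hGd).comp ξ hu'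
    have hY := hSd ξ hξ
    refine ((hu'.hasDerivWithinAt.const_mul σ).prodMk
      ((hGu.hasDerivWithinAt.add (hY.const_mul (δ ^ k))).const_mul (s * κ))).congr_deriv ?_
    have hSne := (hSpos ξ).ne'
    have hfn := hfne ξ hξ
    have hδk : δ ^ k ≠ 0 := pow_ne_zero k hδ.ne'
    have hid := normal_form_identity (u := 1 - ξ ^ 2) (G := G (δ * (1 - ξ ^ 2)))
      (G' := deriv G (δ * (1 - ξ ^ 2))) (ξ := ξ) hk hl hδ.ne' hSne
    have hgz : g (σ * (δ * (1 - ξ ^ 2)))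
        = c * f (σ * (δ * (1 - ξ ^ 2))) * G (δ * (1 - ξ ^ 2)) := by
      have : c ^ 2 = 1 := by
        rw [hc, mul_pow, mul_pow, hs2, hκ2, pow_sq_eq_one_of_sign hσ]; norm_num
      simp only [G]
      clear hid
      generalize f (σ * (δ * (1 - ξ ^ 2))) = fx at hfn
      generalize g (σ * (δ * (1 - ξ ^ 2))) = gx
      field_simp
      linear_combination (-gx) * this
    refine Prod.ext ?_ ?_
    · simp only [field, curve, Prod.smul_fst, smul_eq_mul, ρ]
      rw [← hG' _ hfn]
      generalize f (σ * (δ * (1 - ξ ^ 2))) = fx at hfn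
      field_simp
      linear_combination ξ * δ ^ k * S δ ξ * hκ2
    · simp only [field, curve, Prod.smul_snd, smul_eq_mul, ρ, Nat.add_sub_cancel]
      have h1 : σ ^ (2 * k - 1) = σ := by
        obtain ⟨m, rfl⟩ : ∃ m, k = m + 1 := ⟨k - 1, by omega⟩
        rw [show 2 * (m + 1) - 1 = 2 * m + 1 by omega, pow_succ, pow_mul, hσ2, one_pow, one_mul]
      have h2 : s * κ * σ ^ l * c = σ := by
        rw [hc, hl]
        have := pow_sq_eq_one_of_sign hσ l
        rw [pow_succ]
        linear_combination σ * (s ^ 2 * κ ^ 2 * this + s ^ 2 * hκ2 + hs2)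
      rw [hgz, mul_pow σ _ (2 * k - 1), h1, mul_pow σ _ l]
      push_cast at hid ⊢
      rw [← hid]
      clear hid hgz
      generalize f (σ * (δ * (1 - ξ ^ 2))) = fx at hfn
      generalize G (δ * (1 - ξ ^ 2)) = Gz
      generalize δ * (1 - ξ ^ 2) = z
      have h3 : k * (σ * z ^ (2 * k - 1)) * fx + k * (s * κ * (z ^ (l + 1) * Gz + δ ^ k * (ξ * S δ ξ)))
          * (σ ^ l * z ^ l) * (c * fx * Gz) = σ * k * fx * (z ^ (2 * k - 1) + z ^ l * Gz *
          (z ^ (l + 1) * Gz + δ ^ k * (ξ * S δ ξ))) := by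
        linear_combination k * (z ^ (l + 1) * Gz + δ ^ k * (ξ * S δ ξ)) * z ^ l * fx * Gz * h2
      rw [h3]
      generalize z ^ (2 * k - 1) + z ^ l * Gz * (z ^ (l + 1) * Gz + δ ^ k * (ξ * S δ ξ)) = W
      field_simp
      linear_combination W * hs2 - W * hσ2
  have hy : 0 < δ ^ k * S δ 1 := mul_pos (by positivity) (hSpos 1)
  refine ⟨δ ^ k * S δ 1, hy, by rw [← hS1]; ring, ?_, ?_, ?_, ?_⟩
  · rw [← hcurve1]; exact hmem 1 ⟨one_pos, le_rfl⟩
  · rw [← hcurve0]; exact hball 0 ⟨le_rfl, zero_le_one⟩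
  · intro h
    rw [← hcurve0, ← hcurve1]
    refine conn_of_param hρc hρpos (fun ξ hξ => ?_) fun ξ hξ => hmem ξ ⟨hξ.1, hξ.2.le⟩
    simpa [h] using hvel ξ hξ
  · intro h
    rw [← hcurve0, ← hcurve1]
    refine conn_of_param_neg hρc hρpos (fun ξ hξ => ?_) fun ξ hξ => hmem ξ ⟨hξ.1, hξ.2.le⟩
    simpa [h] using hvel ξ hξ

end NilpotentReturn

namespace NilpotentReturn

open Filter Topology Set

/-! ### The first coefficients of `D` -/

/-- The geometric sum `(1 - (1 - t²)^(2k)) / t²`. -/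
noncomputable def geom (k : ℕ) (t : ℝ) : ℝ := ∑ j ∈ Finset.range (2 * k), (1 - t ^ 2) ^ j

theorem continuous_geom (k : ℕ) : Continuous (geom k) := by
  unfold geom; fun_prop

theorem geom_pos {k : ℕ} (hk : 1 ≤ k) {t : ℝ} (ht : t ∈ Icc (0 : ℝ) 1) : 0 < geom k t := by
  have h0 : 0 ≤ 1 - t ^ 2 := by nlinarith [ht.1, ht.2]
  have h := Finset.single_le_sum (f := fun j => (1 - t ^ 2) ^ j) (s := Finset.range (2 * k))
    (fun j _ => pow_nonneg h0 j) (Finset.mem_range.2 (by omega : 0 < 2 * k))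
  exact lt_of_lt_of_le (by simp) h

theorem sq_mul_geom (k : ℕ) (t : ℝ) : t ^ 2 * geom k t = 1 - (1 - t ^ 2) ^ (2 * k) := by
  have h := mul_neg_geom_sum (1 - t ^ 2) (2 * k)
  rwa [sub_sub_cancel] at h

theorem coeffP_zero {p k : ℕ} (hp : 1 ≤ p) (hk : 1 ≤ k) (F : ℕ → ℝ) (t : ℝ) :
    coeffP p k F 0 t = geom k t := by
  have hk' : (2 * k : ℝ) ≠ 0 := by positivity
  rw [coeffP, coeffA_zero hp, Nat.cast_zero, add_zero, add_zero, div_self hk', one_mul, one_mul]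
  rfl

theorem coeffA_eq_zero {p n : ℕ} (F : ℕ → ℝ) (hn : 0 < n) (hnp : n < 2 * p) :
    coeffA p F n = 0 := by
  simp [coeffA, hn.ne', not_le.2 hnp]

theorem coeffP_eq_zero {p k n : ℕ} (F : ℕ → ℝ) (hn : 0 < n) (hnp : n < 2 * p) (t : ℝ) :
    coeffP p k F n t = 0 := by
  simp [coeffP, coeffA_eq_zero F hn hnp]

theorem coeffV_eq_zero {p k n : ℕ} (F : ℕ → ℝ) (hnp : n < p) (t : ℝ) :
    coeffV p k F n t = 0 := by
  rw [coeffV, if_pos hnp]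

/-- Substitute `x = 1 - t²`: since `1 - (1-t²)^(2k) = t² geom k t`, the root becomes `t √(geom k
t)`. -/
theorem Phi_one {k : ℕ} (q : ℕ) :
    Phi q k 1 = 2 * ∫ t in (0 : ℝ)..1, t ^ 2 * (1 - t ^ 2) ^ (q + k - 1) * √(geom k t) := by
  have h1 : ∀ x ∈ uIcc (0 : ℝ) 1, HasDerivAt (fun t : ℝ => 1 - t ^ 2) (-(2 * x)) x := fun x _ => by
    simpa using (hasDerivAt_pow 2 x).const_sub 1
  have h2 := intervalIntegral.integral_comp_mul_deriv (a := 0) (b := 1)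
    (g := fun s : ℝ => s ^ (q + k - 1) * √(1 - s ^ (2 * k))) h1
    (by fun_prop) (by fun_prop)
  simp only [Phi]
  norm_num at h2 ⊢
  rw [intervalIntegral.integral_symm, neg_neg, intervalIntegral.integral_symm (0 : ℝ) 1,
    intervalIntegral.integral_symm (0 : ℝ) 1, neg_inj] at h2
  rw [← h2, ← intervalIntegral.integral_const_mul]
  refine intervalIntegral.integral_congr fun t ht => ?_
  rw [uIcc_of_le zero_le_one] at ht
  rw [← sq_mul_geom, Real.sqrt_mul (sq_nonneg t), Real.sqrt_sq ht.1]
  ring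

theorem sqrtCoeff_zero (q : ℕ → ℝ) : sqrtCoeff q 0 = √(q 0) := by rw [sqrtCoeff]

theorem sqrtCoeff_one (q : ℕ → ℝ) : sqrtCoeff q 1 = q 1 / (2 * √(q 0)) := by
  rw [sqrtCoeff]; simp

theorem coeffV_self {p k : ℕ} (hp : 1 ≤ p) (hk : 1 ≤ k) (F : ℕ → ℝ) (ξ : ℝ) :
    coeffV p k F p ξ = coeffB p k F 0 * (2 * (ξ ^ 2)⁻¹ *
      ∫ t in (0 : ℝ)..ξ, t ^ 2 * (1 - t ^ 2) ^ (p + k - 1) * √(geom k t)) := by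
  have h : ∫ t in (0 : ℝ)..ξ, t ^ 2 * (1 - t ^ 2) ^ (p + k - 1) *
      coeffR p k F (fun m => if _h : m < p then coeffV p k F m t else 0) t (p - p) =
      coeffB p k F 0 * ∫ t in (0 : ℝ)..ξ, t ^ 2 * (1 - t ^ 2) ^ (p + k - 1) * √(geom k t) := by
    rw [← intervalIntegral.integral_const_mul]
    refine intervalIntegral.integral_congr fun t _ => ?_
    simp only [coeffR, Nat.sub_self, zero_add, Finset.sum_range_one, sqrtCoeff_zero,
      coeffP_zero hp hk, dif_pos (show 0 < p from hp), coeffV_eq_zero F (show 0 < p from hp)]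
    simp only [add_zero, pow_zero, mul_one]
    ring
  rw [coeffV, if_neg (lt_irrefl p), h]
  ring

/-- `A` has no term of degree `1`, so the linear coefficient of the root comes from `coeffV p k F 1`
alone; that is nonzero at most when `p = 1`. -/
theorem coeffV_succ {p k : ℕ} (hp : 1 ≤ p) (hk : 1 ≤ k) (F : ℕ → ℝ) (ξ : ℝ) :
    coeffV p k F (p + 1) ξ = 2 * (ξ ^ 2)⁻¹ *
      ∫ t in (0 : ℝ)..ξ, t ^ 2 * (1 - t ^ 2) ^ (p + k - 1) *
        (√(geom k t) * (coeffB p k F 1 * (1 - t ^ 2)) +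
          coeffV p k F 1 t / (2 * √(geom k t)) * coeffB p k F 0) := by
  rw [coeffV, if_neg (by omega)]
  congr 2
  funext t
  rw [coeffR, Nat.add_sub_cancel_left, Finset.sum_range_succ, Finset.sum_range_one]
  have h0 : coeffV p k F 0 t = 0 := coeffV_eq_zero F hp t
  have h1 : coeffP p k F 1 t = 0 := coeffP_eq_zero F one_pos (by omega) t
  have e0 : (0 : ℕ) < p + 1 := by omega
  have e1 : (1 : ℕ) < p + 1 := by omega
  simp only [sqrtCoeff_zero, sqrtCoeff_one, coeffP_zero hp hk, h0, h1, dif_pos e0, dif_pos e1,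
    Nat.sub_zero, Nat.sub_self, pow_one, pow_zero, mul_one, add_zero, zero_add]

theorem coeffD_zero {p k : ℕ} (hp : 1 ≤ p) (hk : 1 ≤ k) (F : ℕ → ℝ) : coeffD p k F 0 = 1 := by
  have := sq_mul_geom k 1
  have hk' : k ≠ 0 := by omega
  rw [coeffD, coeffP_zero hp hk, coeffV_eq_zero F hp]
  simpa [hk'] using this

theorem coeffD_eq_zero {p k n : ℕ} (F : ℕ → ℝ) (hn : 0 < n) (hnp : n < p) :
    coeffD p k F n = 0 := by
  rw [coeffD, coeffP_eq_zero F hn (by omega), coeffV_eq_zero F hnp, add_zero]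

theorem coeffD_self {p k : ℕ} (hp : 1 ≤ p) (hk : 1 ≤ k) (F : ℕ → ℝ) :
    coeffD p k F p = coeffB p k F 0 * Phi p k 1 := by
  rw [coeffD, coeffP_eq_zero F hp (by omega), coeffV_self hp hk, Phi_one]
  simp

theorem coeffD_succ {p k : ℕ} (hp : 2 ≤ p) (hk : 1 ≤ k) (F : ℕ → ℝ) :
    coeffD p k F (p + 1) = coeffB p k F 1 * Phi (p + 1) k 1 := by
  have hp1 : 1 ≤ p := by omega
  have h1 : ∀ t, coeffV p k F 1 t = 0 := coeffV_eq_zero F hp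
  have e : p + 1 + k - 1 = p + k - 1 + 1 := by omega
  have h : ∫ t in (0 : ℝ)..1, t ^ 2 * (1 - t ^ 2) ^ (p + k - 1) *
        (√(geom k t) * (coeffB p k F 1 * (1 - t ^ 2)) +
          coeffV p k F 1 t / (2 * √(geom k t)) * coeffB p k F 0) = coeffB p k F 1 *
      ∫ t in (0 : ℝ)..1, t ^ 2 * (1 - t ^ 2) ^ (p + 1 + k - 1) * √(geom k t) := by
    rw [← intervalIntegral.integral_const_mul]
    refine intervalIntegral.integral_congr fun t _ => ?_
    simp only [h1, e, pow_succ]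
    ring
  rw [coeffD, coeffP_eq_zero F (Nat.succ_pos p) (by omega), coeffV_succ hp1 hk, Phi_one, h]
  ring

/-- The apparent singularity `t⁻²` is harmless: on `[0,1]` the coefficient is the average of a
continuous function. -/
theorem intervalIntegrable_coeffV_one {k : ℕ} (hk : 1 ≤ k) (F : ℕ → ℝ) :
    IntervalIntegrable (fun t => t ^ 2 * (1 - t ^ 2) ^ (1 + k - 1) *
      (coeffV 1 k F 1 t / (2 * √(geom k t)) * coeffB 1 k F 0)) MeasureTheory.volume 0 1 := by
  let ψ : CI := ⟨fun t => coeffB 1 k F 0 * (2 * (t * (1 - (t : ℝ) ^ 2) ^ (1 + k - 1)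
    * √(geom k t))), by have := continuous_geom k; fun_prop⟩
  have hψ : ∀ t (ht : t ∈ Icc (0 : ℝ) 1), coeffV 1 k F 1 t = avg ψ ⟨t, ht⟩ := by
    intro t ht
    rw [coeffV_self le_rfl hk]
    rcases eq_or_ne t 0 with rfl | h0
    · rw [avg_zero _ _ rfl]; simp [ψ]
    · refine mul_left_cancel₀ (pow_ne_zero 2 h0) ?_
      rw [sq_mul_avg ψ ⟨t, ht⟩, ← intervalIntegral.integral_const_mul,
        ← intervalIntegral.integral_const_mul, ← intervalIntegral.integral_const_mul]
      refine intervalIntegral.integral_congr fun x hx => ?_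
      rw [uIcc_of_le ht.1] at hx
      simp only [ext_of_mem ψ ⟨hx.1, hx.2.trans ht.2⟩, ψ, ContinuousMap.coe_mk]
      field_simp
  refine ContinuousOn.intervalIntegrable ?_
  rw [uIcc_of_le zero_le_one]
  have hc : ContinuousOn (fun t => t ^ 2 * (1 - t ^ 2) ^ (1 + k - 1) *
      (ext (avg ψ) t / (2 * √(geom k t)) * coeffB 1 k F 0)) (Icc 0 1) := by
    have h1 := continuous_ext (avg ψ)
    have h2 := continuous_geom k
    have h3 : ∀ t ∈ Icc (0 : ℝ) 1, 2 * √(geom k t) ≠ 0 := fun t ht => by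
      have := Real.sqrt_pos.2 (geom_pos hk ht); positivity
    fun_prop (disch := assumption)
  refine hc.congr fun t ht => ?_
  simp only [hψ t ht, ext_of_mem _ ht]

/-- The constant `w`, which contains a genuine double integral, is independent of `F`. Its value
never matters: `F 0 ^ 2` is unchanged by `J₂`, so this term cancels in the matching. -/
theorem coeffD_two {k : ℕ} (hk : 1 ≤ k) :
    ∃ w : ℝ, ∀ F : ℕ → ℝ, coeffD 1 k F 2 = coeffB 1 k F 1 * Phi 2 k 1 + F 0 ^ 2 * w := by
  refine ⟨2 * k / (2 * k + 2) * (∑ j ∈ Finset.range (2 * k + 2), (1 - (1 : ℝ) ^ 2) ^ j) +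
    (2 * (1 + 2 * k)) ^ 2 * (2 * ∫ t in (0 : ℝ)..1, t ^ 2 * (1 - t ^ 2) ^ (1 + k - 1) *
      ((2 * (t ^ 2)⁻¹ * ∫ u in (0 : ℝ)..t, u ^ 2 * (1 - u ^ 2) ^ (1 + k - 1) * √(geom k u))
        / (2 * √(geom k t)))), fun F => ?_⟩
  have hA : coeffA 1 F 2 = F 0 ^ 2 := by simp [coeffA, sq]
  have hB : coeffB 1 k F 0 = 2 * (1 + 2 * k) * F 0 := by simp [coeffB]
  have hV : coeffV 1 k F 2 1 = coeffB 1 k F 1 * Phi 2 k 1 + coeffB 1 k F 0 ^ 2 *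
    (2 * ∫ t in (0 : ℝ)..1, t ^ 2 * (1 - t ^ 2) ^ (1 + k - 1) *
      ((2 * (t ^ 2)⁻¹ * ∫ u in (0 : ℝ)..t, u ^ 2 * (1 - u ^ 2) ^ (1 + k - 1) * √(geom k u))
        / (2 * √(geom k t)))) := by
    have h1 := coeffV_succ le_rfl hk F (1 : ℝ)
    rw [show (1 : ℕ) + 1 = 2 from rfl] at h1
    have hint : IntervalIntegrable (fun t : ℝ => t ^ 2 * (1 - t ^ 2) ^ (1 + k - 1) *
        (√(geom k t) * (coeffB 1 k F 1 * (1 - t ^ 2)))) MeasureTheory.volume 0 1 := by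
      have := continuous_geom k
      exact (by fun_prop : Continuous _).intervalIntegrable _ _
    simp only [mul_add] at h1
    rw [intervalIntegral.integral_add hint (intervalIntegrable_coeffV_one hk F)] at h1
    have e : 2 + k - 1 = 1 + k - 1 + 1 := by omega
    have h2 : ∫ t in (0 : ℝ)..1, t ^ 2 * (1 - t ^ 2) ^ (1 + k - 1) *
        (√(geom k t) * (coeffB 1 k F 1 * (1 - t ^ 2))) = coeffB 1 k F 1 *
        ∫ t in (0 : ℝ)..1, t ^ 2 * (1 - t ^ 2) ^ (2 + k - 1) * √(geom k t) := by
      rw [← intervalIntegral.integral_const_mul]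
      refine intervalIntegral.integral_congr fun t _ => ?_
      simp only [e, pow_succ]; ring
    have h3 : ∫ t in (0 : ℝ)..1, t ^ 2 * (1 - t ^ 2) ^ (1 + k - 1) *
        (coeffV 1 k F 1 t / (2 * √(geom k t)) * coeffB 1 k F 0) = coeffB 1 k F 0 ^ 2 *
        ∫ t in (0 : ℝ)..1, t ^ 2 * (1 - t ^ 2) ^ (1 + k - 1) *
        ((2 * (t ^ 2)⁻¹ * ∫ u in (0 : ℝ)..t, u ^ 2 * (1 - u ^ 2) ^ (1 + k - 1) * √(geom k u))
        / (2 * √(geom k t))) := by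
      rw [← intervalIntegral.integral_const_mul]
      refine intervalIntegral.integral_congr fun t _ => ?_
      simp only [coeffV_self le_rfl hk F t]
      ring
    rw [h1, Phi_one, h2, h3]
    ring
  rw [coeffD, hV, coeffP, hA, hB]
  push_cast
  ring

end NilpotentReturn

namespace NilpotentReturn

open PowerSeries

/-! ### The first coefficients of the matching map -/

theorem coeff_of_X_pow_dvd_sub {A B : PowerSeries ℝ} {n N : ℕ} (h : X ^ N ∣ A - B) (hn : n < N) :
    coeff n A = coeff n B := by
  have := X_pow_dvd_iff.1 h n hn
  rwa [map_sub, sub_eq_zero] at this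

/-- Below degree `2p` the matching is linear: the outer power contributes `2kc X^p`, while the inner
dilation alters only terms `X^j` with `j ≥ p`, each by a multiple of `X^(j+p)`. -/
theorem coeff_truncated_match {k p n : ℕ} (hn : n < 2 * p) {d' : ℕ → ℝ} (h0 : d' 0 = 1)
    (hd' : ∀ m, 0 < m → m < p → d' m = 0) (c : ℝ) :
    coeff n ((1 + C c * X ^ p) ^ (2 * k) * ∑ j ∈ Finset.range (n + 1),
      C (d' j) * (X * (1 + C c * X ^ p)) ^ j) = d' n + if n = p then 2 * k * c else 0 := by
  have h1 : X ^ (2 * p) ∣ (1 + C c * X ^ p) ^ (2 * k) - (1 + C (2 * k * c) * X ^ p) := by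
    obtain ⟨Q, hQ⟩ := Polynomial.powAddExpansion (1 : PowerSeries ℝ) (C c * X ^ p) (2 * k)
    refine ⟨Q * C c ^ 2, ?_⟩
    rw [hQ]
    push_cast
    simp only [map_mul, map_natCast, map_ofNat, one_pow]
    ring
  set P₀ : PowerSeries ℝ := ∑ j ∈ Finset.range (n + 1), C (d' j) * X ^ j with hP₀
  have h2 : X ^ (2 * p) ∣ ∑ j ∈ Finset.range (n + 1), C (d' j) * (X * (1 + C c * X ^ p)) ^ j
      - P₀ := by
    rw [hP₀, ← Finset.sum_sub_distrib]
    refine Finset.dvd_sum fun j _ => ?_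
    rcases Nat.eq_zero_or_pos j with rfl | hj
    · simp
    rcases lt_or_ge j p with hjp | hjp
    · simp [hd' j hj hjp]
    rw [← mul_sub]
    refine Dvd.dvd.mul_left ?_ _
    have h3 : X ^ p ∣ (1 + C c * X ^ p) ^ j - 1 := by
      have h4 := sub_dvd_pow_sub_pow (1 + C c * X ^ p) (1 : PowerSeries ℝ) j
      rw [one_pow, add_sub_cancel_left] at h4
      exact (Dvd.intro_left _ rfl).trans h4
    have h5 : (X * (1 + C c * X ^ p)) ^ j - X ^ j = X ^ j * ((1 + C c * X ^ p) ^ j - 1) := by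
      rw [mul_pow]; ring
    rw [h5, two_mul, pow_add]
    exact mul_dvd_mul (pow_dvd_pow X hjp) h3
  have h3 : X ^ p ∣ P₀ - 1 := by
    rw [hP₀, Finset.sum_range_succ', h0]
    simp only [map_one, pow_zero, mul_one, add_sub_cancel_right]
    refine Finset.dvd_sum fun j _ => ?_
    rcases lt_or_ge (j + 1) p with hjp | hjp
    · simp [hd' (j + 1) (Nat.succ_pos j) hjp]
    · exact (pow_dvd_pow X hjp).mul_left _
  have h4 : X ^ (2 * p) ∣ (1 + C c * X ^ p) ^ (2 * k) * ∑ j ∈ Finset.range (n + 1),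
      C (d' j) * (X * (1 + C c * X ^ p)) ^ j - (P₀ + C (2 * k * c) * X ^ p) := by
    obtain ⟨a, ha⟩ := h1
    obtain ⟨b, hb⟩ := h2
    obtain ⟨e, he⟩ := h3
    rw [sub_eq_iff_eq_add] at ha hb he
    rw [ha, hb]
    refine ⟨a * P₀ + (a * X ^ (2 * p) + (1 + C (2 * k * c) * X ^ p)) * b
      + C (2 * k * c) * e, ?_⟩
    have : C (2 * k * c) * X ^ p * P₀ = C (2 * k * c) * X ^ p * (X ^ p * e + 1) := by rw [← he]
    linear_combination this
  rw [coeff_of_X_pow_dvd_sub h4 hn, map_add, coeff_C_mul, coeff_X_pow, hP₀, map_sum]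
  congr 1
  · rw [Finset.sum_eq_single n]
    · simp
    · intro j _ hj
      simp [coeff_X_pow, hj.symm]
    · simp
  · simp

theorem matchCoeff_small {k p : ℕ} {d d' : ℕ → ℝ} (h0 : d' 0 = 1)
    (hd : ∀ m, 0 < m → m < p → d m = 0)
    (hd' : ∀ m, 0 < m → m < p → d' m = 0) :
    ∀ n, 0 < n → n < p → matchCoeff k d d' n = 0 := by
  intro n
  induction n using Nat.strong_induction_on with
  | _ n ih =>
    intro hn hnp
    have hT : (PowerSeries.mk fun m => if _h : m < n then matchCoeff k d d' m else 0)
        = 1 + C 0 * X ^ p := by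
      ext m
      rw [coeff_mk]
      rcases Nat.eq_zero_or_pos m with rfl | hm
      · simp [hn, matchCoeff_zero]
      · simp [coeff_one, hm.ne']
        intro hmn
        exact ih m hmn hm (hmn.trans hnp)
    rw [matchCoeff, if_neg hn.ne']
    simp only [hT]
    rw [coeff_truncated_match (by omega) h0 hd', hd n hn hnp, hd' n hn hnp]
    simp

theorem matchCoeff_self {k p : ℕ} (hp : 1 ≤ p) {d d' : ℕ → ℝ} (h0 : d' 0 = 1)
    (hd : ∀ m, 0 < m → m < p → d m = 0)
    (hd' : ∀ m, 0 < m → m < p → d' m = 0) :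
    matchCoeff k d d' p = (d p - d' p) / (2 * k) := by
  have hT : (PowerSeries.mk fun m => if _h : m < p then matchCoeff k d d' m else 0)
      = 1 + C 0 * X ^ p := by
    ext m
    rw [coeff_mk]
    rcases Nat.eq_zero_or_pos m with rfl | hm
    · have : 0 < p := hp
      simp [this, matchCoeff_zero]
    · simp [coeff_one, hm.ne']
      exact matchCoeff_small h0 hd hd' m hm
  rw [matchCoeff, if_neg (by omega)]
  simp only [hT]
  rw [coeff_truncated_match (by omega) h0 hd']
  simp

theorem mk_truncated_succ {p : ℕ} (hp : 1 ≤ p) {a : ℕ → ℝ} (h0 : a 0 = 1)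
    (ha : ∀ m, 0 < m → m < p → a m = 0) :
    (PowerSeries.mk fun m => if _h : m < p + 1 then a m else 0) = 1 + C (a p) * X ^ p := by
  ext m
  rw [coeff_mk, map_add, coeff_C_mul, coeff_X_pow, coeff_one]
  rcases Nat.eq_zero_or_pos m with rfl | hm
  · have : 0 ≠ p := by omega
    simp [h0, this]
  · rcases lt_trichotomy m p with h | rfl | h
    · simp [hm.ne', h.ne, ha m hm h]
    · simp [hm.ne']
    · have : ¬ m < p + 1 := by omega
      simp [hm.ne', h.ne', this]

theorem matchCoeff_succ {k p : ℕ} (hp : 2 ≤ p) {d d' : ℕ → ℝ} (h0 : d' 0 = 1)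
    (hd : ∀ m, 0 < m → m < p → d m = 0)
    (hd' : ∀ m, 0 < m → m < p → d' m = 0) :
    matchCoeff k d d' (p + 1) = (d (p + 1) - d' (p + 1)) / (2 * k) := by
  have hT := mk_truncated_succ (by omega : 1 ≤ p) (matchCoeff_zero k d d')
    (matchCoeff_small h0 hd hd')
  rw [matchCoeff, if_neg (by omega)]
  simp only [hT]
  rw [coeff_truncated_match (by omega) h0 hd']
  simp

theorem exists_one_add_pow (a : ℝ) (m : ℕ) : ∃ R : PowerSeries ℝ,
    (1 + C a * X) ^ m = 1 + C (m * a) * X + C (m * (m - 1) / 2 * a ^ 2) * X ^ 2 + X ^ 3 * R := by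
  induction m with
  | zero => exact ⟨0, by simp⟩
  | succ m ih =>
    obtain ⟨R, hR⟩ := ih
    refine ⟨R * (1 + C a * X) + C (m * (m - 1) / 2 * a ^ 2) * C a, ?_⟩
    rw [pow_succ, hR]
    have e1 : ((m + 1 : ℕ) : ℝ) * a = m * a + a := by push_cast; ring
    have e2 : ((m + 1 : ℕ) : ℝ) * ((m + 1 : ℕ) - 1) / 2 * a ^ 2
      = m * (m - 1) / 2 * a ^ 2 + m * a * a := by push_cast; ring
    rw [e1, e2, map_add, map_add, map_mul _ (m * a) a]
    ring

theorem coeff_two_quadratic (a₀ a₁ a₂ : ℝ) (R : PowerSeries ℝ) :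
    coeff 2 (C a₀ + C a₁ * X + C a₂ * X ^ 2 + X ^ 3 * R) = a₂ := by
  have h : coeff 2 (X ^ 3 * R) = 0 := X_pow_dvd_iff.1 (Dvd.intro R rfl) 2 (by norm_num)
  rw [map_add, h]
  simp [coeff_X_pow]

/-- For `p = 1` degree `2` equals `2p`, the first degree with quadratic effects. In the factor `2k +
1`, the outer power accounts for `2k` and the inner dilation for `1`. -/
theorem matchCoeff_two {k : ℕ} {d d' : ℕ → ℝ} (h0 : d' 0 = 1) :
    matchCoeff k d d' 2 = (d 2 - d' 2 - (k * (2 * k - 1) * matchCoeff k d d' 1 ^ 2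
      + (2 * k + 1) * matchCoeff k d d' 1 * d' 1)) / (2 * k) := by
  have hT := mk_truncated_succ le_rfl (matchCoeff_zero k d d') fun m h1 h2 => by omega
  rw [matchCoeff, if_neg (by norm_num)]
  simp only [show 2 = 1 + 1 from rfl, hT]
  norm_num
  generalize matchCoeff k d d' 1 = a
  obtain ⟨R, hR⟩ := exists_one_add_pow a (2 * k)
  have h : (1 + C a * X) ^ (2 * k) * ∑ j ∈ Finset.range 3, C (d' j) * (X * (1 + C a * X)) ^ j
      = C 1 + C (2 * k * a + d' 1) * X + C (k * (2 * k - 1) * a ^ 2 + 2 * k * a * d' 1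
        + d' 1 * a + d' 2) * X ^ 2 + X ^ 3 * (R * ∑ j ∈ Finset.range 3, C (d' j)
          * (X * (1 + C a * X)) ^ j + C (2 * k * a) * (C (d' 1) * C a + C (d' 2) * (1 + C a * X) ^ 2)
          + C (k * (2 * k - 1) * a ^ 2) * (C (d' 1) * (1 + C a * X) + X * C (d' 2) *
            (1 + C a * X) ^ 2) + C (d' 2) * (2 * C a + C a ^ 2 * X)) := by
    rw [hR]
    have e : ((2 * k : ℕ) : ℝ) * ((2 * k : ℕ) - 1) / 2 * a ^ 2 = k * (2 * k - 1) * a ^ 2 := by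
      push_cast; ring
    rw [e]
    push_cast
    simp only [Finset.sum_range_succ, Finset.sum_range_zero, h0, map_add, map_mul (C (R := ℝ)),
      map_one]
    ring
  rw [h, coeff_two_quadratic]
  ring

/-! ### The first coefficients of `Z` -/

theorem coeffZ_eq (p k : ℕ) (F : ℕ → ℝ) (n : ℕ) :
    coeffZ p k F n = coeff n (X * PowerSeries.mk (coeffN p k F) *
      psComp (coeffN p k (J₃ p k F)) (X * PowerSeries.mk (coeffN p k F))) := by
  rw [coeffZ, coeff_mul_psComp (Dvd.intro _ rfl)]

theorem mk_congr_two {p : ℕ} (hp : 1 ≤ p) {a : ℕ → ℝ} (h0 : a 0 = 1)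
    (ha : ∀ m, 0 < m → m < p → a m = 0) :
    ∃ R, PowerSeries.mk a = 1 + C (a p) * X ^ p + C (a (p + 1)) * X ^ (p + 1) + X ^ (p + 2) * R := by
  have : X ^ (p + 2) ∣ PowerSeries.mk a - (1 + C (a p) * X ^ p + C (a (p + 1)) * X ^ (p + 1)) := by
    rw [X_pow_dvd_iff]
    intro m hm
    simp only [map_sub, map_add, coeff_mk, coeff_C_mul, coeff_X_pow, coeff_one]
    rcases Nat.eq_zero_or_pos m with rfl | hm0
    · have : 0 ≠ p := by omega
      simp [h0, this]
    rcases lt_trichotomy m p with h | rfl | h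
    · have : m ≠ p + 1 := by omega
      simp [hm0.ne', h.ne, this, ha m hm0 h]
    · simp [hm0.ne']
    · obtain rfl : m = p + 1 := by omega
      simp
  obtain ⟨R, hR⟩ := this
  exact ⟨R, by rw [← hR]; ring⟩

theorem sum_range_sparse {p : ℕ} (hp : 1 ≤ p) {c : ℕ → ℝ} (h0 : c 0 = 1)
    (hc : ∀ m, 0 < m → m < p → c m = 0) (H : PowerSeries ℝ) :
    ∑ j ∈ Finset.range (p + 2), C (c j) * H ^ j
      = 1 + C (c p) * H ^ p + C (c (p + 1)) * H ^ (p + 1) := by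
  rw [Finset.sum_range_succ, Finset.sum_range_succ]
  congr 2
  rw [Finset.sum_eq_single_of_mem 0 (by simp; omega)]
  · simp [h0]
  · intro j hj hj0
    simp [hc j (Nat.pos_of_ne_zero hj0) (Finset.mem_range.1 hj)]

/-- The expansion of `h (ν' ∘ h)` up to the second nontrivial coefficient. -/
theorem exists_mul_psComp {p : ℕ} (hp : 1 ≤ p) {a c : ℕ → ℝ} (ha0 : a 0 = 1)
    (ha : ∀ m, 0 < m → m < p → a m = 0) (hc0 : c 0 = 1) (hc : ∀ m, 0 < m → m < p → c m = 0) :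
    ∃ R, X * PowerSeries.mk a * psComp c (X * PowerSeries.mk a) =
      X + C (a p + c p) * X ^ (p + 1) + C (a (p + 1) + c (p + 1)) * X ^ (p + 2)
        + C ((p + 1) * a p * c p) * X ^ (2 * p + 1) + X ^ (p + 3) * R := by
  obtain ⟨R, hR⟩ := mk_congr_two hp ha0 ha
  set N := PowerSeries.mk a with hN
  obtain ⟨S, hS⟩ := X_pow_dvd_psComp_sub (c := c) (Dvd.intro N rfl : X ∣ X * N) (p + 1)
  rw [sum_range_sparse hp hc0 hc, sub_eq_iff_eq_add] at hS
  -- The term of degree `p` here produces the product `a p * c p` in degree `2p + 1`, which lies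
  -- within the range up to `p + 2` only for `p = 1`.
  obtain ⟨Q, hQ⟩ : ∃ Q, N ^ (p + 1) = 1 + C ((p + 1) * a p) * X ^ p + X ^ (p + 1) * Q := by
    have hN1 : N = 1 + X ^ p * (C (a p) + X * (C (a (p + 1)) + X * R)) := by rw [hR]; ring
    obtain ⟨Q, hQ⟩ := Polynomial.powAddExpansion (1 : PowerSeries ℝ)
      (X ^ p * (C (a p) + X * (C (a (p + 1)) + X * R))) (p + 1)
    obtain ⟨m, rfl⟩ : ∃ m, p = m + 1 := ⟨p - 1, by omega⟩
    refine ⟨((m + 1 + 1 : ℕ) : PowerSeries ℝ) * (C (a (m + 1 + 1)) + X * R) +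
      Q * X ^ m * (C (a (m + 1)) + X * (C (a (m + 1 + 1)) + X * R)) ^ 2, ?_⟩
    rw [hN1, hQ]
    push_cast
    simp only [map_mul, map_add, map_natCast, map_one, one_pow]
    ring
  obtain ⟨W, hW⟩ : ∃ W, N ^ (p + 2) = 1 + X * W := by
    have hN1 : X ∣ N - 1 := by
      rw [X_dvd_iff, map_sub, map_one, ← coeff_zero_eq_constantCoeff_apply, hN, coeff_mk, ha0,
        sub_self]
    have h := hN1.trans (sub_dvd_pow_sub_pow N 1 (p + 2))
    rw [one_pow] at h
    obtain ⟨W, hW⟩ := h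
    exact ⟨W, by rw [← hW]; ring⟩
  refine ⟨R + N * S + C (c p) * Q * X ^ (p - 1) + C (c (p + 1)) * W, ?_⟩
  have hXp : X ^ (p - 1) * X = (X ^ p : PowerSeries ℝ) := by
    rw [← pow_succ]; congr 1; omega
  have e1 : X * N * psComp c (X * N) = X * N + C (c p) * X ^ (p + 1) * N ^ (p + 1)
      + C (c (p + 1)) * X ^ (p + 2) * N ^ (p + 2) + X ^ (p + 3) * (N * S) := by
    rw [hS]; ring
  rw [e1, hQ, hW]
  have e2 : C ((p + 1) * a p * c p) = C ((p + 1) * a p) * C (c p) := map_mul _ _ _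
  rw [e2, map_add, map_add]
  linear_combination X * hR - C (c p) * Q * X ^ (p + 2) * hXp

end NilpotentReturn

/-! ### Closed forms for the leading coefficients of the matching maps and of `Z` -/

namespace NilpotentReturn

open PowerSeries

theorem coeffB_zero (p k : ℕ) (F : ℕ → ℝ) : coeffB p k F 0 = 2 * (p + 2 * k) * F 0 := by
  simp [coeffB]

theorem coeffB_one (p k : ℕ) (F : ℕ → ℝ) : coeffB p k F 1 = 2 * (p + 2 * k + 1) * F 1 := by
  simp [coeffB]; ring

theorem theta_sq (p k : ℕ) : theta p k ^ 2 = 1 := by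
  rw [theta, ← pow_mul, mul_comm, pow_mul]; norm_num

theorem neg_one_pow_eq_neg_theta {p : ℕ} (hp : 1 ≤ p) (k : ℕ) :
    (-1 : ℝ) ^ (p + k) = -theta p k := by
  obtain ⟨m, hm⟩ : ∃ m, p + k = m + 1 := ⟨p + k - 1, by omega⟩
  rw [theta, hm, Nat.add_sub_cancel, pow_succ]; ring

theorem J₂_zero {p : ℕ} (hp : 1 ≤ p) (k : ℕ) (F : ℕ → ℝ) : J₂ p k F 0 = -theta p k * F 0 := by
  simp [J₂, neg_one_pow_eq_neg_theta hp]

theorem J₂_one {p : ℕ} (hp : 1 ≤ p) (k : ℕ) (F : ℕ → ℝ) : J₂ p k F 1 = theta p k * F 1 := by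
  simp [J₂, neg_one_pow_eq_neg_theta hp]

theorem J₃_zero (p k : ℕ) (F : ℕ → ℝ) : J₃ p k F 0 = theta p k * F 0 := by
  simp [J₃, theta]

theorem J₃_one (p k : ℕ) (F : ℕ → ℝ) : J₃ p k F 1 = -theta p k * F 1 := by
  simp [J₃, theta]

theorem coeffN_zero (p k : ℕ) (F : ℕ → ℝ) : coeffN p k F 0 = 1 := matchCoeff_zero _ _ _

theorem coeffN_eq_zero {p k : ℕ} (hk : 1 ≤ k) (F : ℕ → ℝ) (m : ℕ) (hm : 0 < m) (hmp : m < p) :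
    coeffN p k F m = 0 :=
  matchCoeff_small (coeffD_zero (by omega) hk _) (fun _ => coeffD_eq_zero _)
    (fun _ => coeffD_eq_zero _) m hm hmp

theorem coeffN_self {p k : ℕ} (hp : 1 ≤ p) (hk : 1 ≤ k) (F : ℕ → ℝ) :
    coeffN p k F p = (1 + theta p k) * (2 * (p + 2 * k) * F 0) * Phi p k 1 / (2 * k) := by
  rw [coeffN, matchCoeff_self hp (coeffD_zero hp hk _) (fun _ => coeffD_eq_zero _)
    (fun _ => coeffD_eq_zero _), coeffD_self hp hk, coeffD_self hp hk, coeffB_zero, coeffB_zero,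
    J₂_zero hp]
  ring

theorem coeffN_succ {p k : ℕ} (hp : 2 ≤ p) (hk : 1 ≤ k) (F : ℕ → ℝ) :
    coeffN p k F (p + 1)
      = (1 - theta p k) * (2 * (p + 2 * k + 1) * F 1) * Phi (p + 1) k 1 / (2 * k) := by
  have hp1 : 1 ≤ p := by omega
  rw [coeffN, matchCoeff_succ hp (coeffD_zero hp1 hk _) (fun _ => coeffD_eq_zero _)
    (fun _ => coeffD_eq_zero _), coeffD_succ hp hk, coeffD_succ hp hk, coeffB_one, coeffB_one,
    J₂_one hp1]
  ring

theorem coeffN_two {k : ℕ} (hk : 1 ≤ k) (F : ℕ → ℝ) :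
    coeffN 1 k F 2 = ((1 - theta 1 k) * (2 * (1 + 2 * k + 1) * F 1) * Phi 2 k 1
      + (1 + theta 1 k) / k * (2 * (1 + 2 * k) * F 0) ^ 2 * Phi 1 k 1 ^ 2) / (2 * k) := by
  obtain ⟨w, hw⟩ := coeffD_two hk
  have hN := coeffN_self le_rfl hk F
  rw [coeffN] at hN ⊢
  rw [matchCoeff_two (coeffD_zero le_rfl hk _), hN, hw, hw, coeffD_self le_rfl hk, coeffB_zero,
    coeffB_one, coeffB_one, J₂_zero le_rfl, J₂_one le_rfl]
  have hk' : (k : ℝ) ≠ 0 := by positivity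
  -- If `θ = 1`, then `J₂` flips `F 0` and the quadratic terms survive; if `θ = -1`, the first
  -- matching coefficient is zero and they disappear.
  rcases sq_eq_one_iff.1 (theta_sq 1 k) with h | h
  · rw [h]; push_cast; field_simp; ring
  · rw [h]; push_cast; field_simp; ring

/-- The coefficients of `Z` up to the second nontrivial one. -/
theorem coeffZ_of_le {p k : ℕ} (hp : 1 ≤ p) (hk : 1 ≤ k) (F : ℕ → ℝ) {n : ℕ} (hn : n ≤ p + 2) :
    coeffZ p k F n = (if n = 1 then 1 else 0)
      + (if n = p + 1 then coeffN p k F p + coeffN p k (J₃ p k F) p else 0)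
      + (if n = p + 2 then coeffN p k F (p + 1) + coeffN p k (J₃ p k F) (p + 1) else 0)
      + (if n = 2 * p + 1 then (p + 1) * coeffN p k F p * coeffN p k (J₃ p k F) p else 0) := by
  obtain ⟨R, hR⟩ := exists_mul_psComp hp (coeffN_zero p k F) (coeffN_eq_zero hk F)
    (coeffN_zero p k (J₃ p k F)) (coeffN_eq_zero hk (J₃ p k F))
  have h0 : coeff n (X ^ (p + 3) * R) = 0 :=
    X_pow_dvd_iff.1 (Dvd.intro R rfl) n (by omega)
  rw [coeffZ_eq, hR, map_add, h0, map_add, map_add, map_add]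
  simp only [coeff_C_mul, coeff_X_pow, coeff_X, mul_ite, mul_one, mul_zero, add_zero]

theorem coeffZ_form {p k : ℕ} (hp : 1 ≤ p) (hk : 1 ≤ k) (F : ℕ → ℝ) :
    coeffZ p k F 0 = 0 ∧ coeffZ p k F 1 = 1 ∧ ∀ n, 2 ≤ n → n < p + 1 → coeffZ p k F n = 0 := by
  refine ⟨?_, ?_, fun n h1 h2 => ?_⟩
  · rw [coeffZ_of_le hp hk F (Nat.zero_le _)]; simp
  · rw [coeffZ_of_le hp hk F (by omega)]
    have h1 : p ≠ 0 ∧ 0 ≠ p := by omega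
    simp [h1]
  · rw [coeffZ_of_le hp hk F (by omega), if_neg (by omega), if_neg (by omega), if_neg (by omega),
      if_neg (by omega)]
    simp

theorem coeffZ_of_two_le {p k : ℕ} (hp : 2 ≤ p) (hk : 1 ≤ k) (F : ℕ → ℝ) :
    coeffZ p k F (p + 1) = 2 * (2 * (p + 2 * k) * F 0 * Phi p k 1 / (2 * k)) * (1 + theta p k) ∧
    coeffZ p k F (p + 2)
      = 2 * (2 * (p + 2 * k + 1) * F 1 * Phi (p + 1) k 1 / (2 * k)) * (1 - theta p k) := by
  have hp1 : 1 ≤ p := by omega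
  -- The two half turns contribute `(1 ± θ) + (±θ)(1 ± θ) = (1 ± θ)²`, which is `2(1 ± θ)` because
  -- `θ² = 1`.
  have hθ := theta_sq p k
  constructor
  · rw [coeffZ_of_le hp1 hk F (by omega), if_neg (by omega), if_pos rfl, if_neg (by omega),
      if_neg (by omega), coeffN_self hp1 hk, coeffN_self hp1 hk, J₃_zero]
    linear_combination 2 * (p + 2 * k) * F 0 * Phi p k 1 / (2 * k) * hθ
  · rw [coeffZ_of_le hp1 hk F le_rfl, if_neg (by omega), if_neg (by omega), if_pos rfl,
      if_neg (by omega), coeffN_succ hp hk, coeffN_succ hp hk, J₃_one]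
    linear_combination 2 * (p + 2 * k + 1) * F 1 * Phi (p + 1) k 1 / (2 * k) * hθ

theorem coeffZ_one {k : ℕ} (hk : 1 ≤ k) (F : ℕ → ℝ) :
    coeffZ 1 k F 2 = 2 * (2 * (1 + 2 * k) * F 0 * Phi 1 k 1 / (2 * k)) * (1 + theta 1 k) ∧
    coeffZ 1 k F 3 = 2 * (((1 - theta 1 k) * (2 * (1 + 2 * k + 1) * F 1) * Phi 2 k 1
      + (1 + theta 1 k) / k * (2 * (1 + 2 * k) * F 0) ^ 2 * Phi 1 k 1 ^ 2) / (2 * k)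
      + (2 * (1 + 2 * k) * F 0 * Phi 1 k 1 / (2 * k) * (1 + theta 1 k)) ^ 2) := by
  have hθ := theta_sq 1 k
  constructor
  · rw [coeffZ_of_le le_rfl hk F (by omega), coeffN_self le_rfl hk, coeffN_self le_rfl hk, J₃_zero]
    norm_num
    linear_combination 2 * (1 + 2 * k) * F 0 * Phi 1 k 1 / (2 * k) * hθ
  · rw [coeffZ_of_le le_rfl hk F (by omega), coeffN_self le_rfl hk, coeffN_self le_rfl hk,
      coeffN_two hk, coeffN_two hk, J₃_zero, J₃_one]
    norm_num
    rcases sq_eq_one_iff.1 hθ with h | h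
    · rw [h]; ring
    · rw [h]; ring

end NilpotentReturn

/-! ### The full turn, transversality and the main theorem -/

namespace NilpotentReturn

open Filter Topology Set

/-- The first return map: orbits through all four quadrants. -/
theorem exists_return {k l p : ℕ} (hk : 1 ≤ k) (hp : 1 ≤ p) (hl : p + k = l + 1)
    {f g : ℝ → ℝ} (hf : AnalyticAt ℝ f 0) {s : ℝ} (hs : s = 1 ∨ s = -1)
    (hsf : 0 < s * f 0) {a : ℕ → ℝ} (ha : HasSer (fun z => g z / f z) a) :
    ∃ Z : ℝ → ℝ, HasSer Z (coeffZ p k fun n => s * a n) ∧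
      ∀ r > 0, ∀ᶠ ε in 𝓝[>] (0 : ℝ), 0 < Z ε ∧ Z ε < r ∧
        (ε, ε ^ (l + 1) * g ε / f ε) ∈ Metric.ball (0 : ℝ × ℝ) r ∧
        (Z ε, Z ε ^ (l + 1) * g (Z ε) / f (Z ε)) ∈ Metric.ball (0 : ℝ × ℝ) r ∧
        Conn (field k l f g) (Metric.ball 0 r \ arc l f g r) (ε, ε ^ (l + 1) * g ε / f ε)
          (Z ε, Z ε ^ (l + 1) * g (Z ε) / f (Z ε)) := by
  set F : ℕ → ℝ := fun n => s * a n with hF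
  obtain ⟨m, hm⟩ : ∃ m, p + k = m + 1 := ⟨p + k - 1, by omega⟩
  obtain ⟨D₁, hD₁, h₁⟩ := exists_quarter_orbit hk hp hl hf hs hsf (σ := 1) (κ := 1)
    (Or.inl rfl) (Or.inl rfl) ha
  obtain ⟨D₂, hD₂, h₂⟩ := exists_quarter_orbit hk hp hl hf hs hsf (σ := -1) (κ := 1)
    (Or.inr rfl) (Or.inl rfl) ha
  obtain ⟨D₃, hD₃, h₃⟩ := exists_quarter_orbit hk hp hl hf hs hsf (σ := -1) (κ := -1)
    (Or.inr rfl) (Or.inr rfl) ha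
  obtain ⟨D₄, hD₄, h₄⟩ := exists_quarter_orbit hk hp hl hf hs hsf (σ := 1) (κ := -1)
    (Or.inl rfl) (Or.inr rfl) ha
  have e₁ : (fun n => s * 1 * 1 ^ (p + k) * (1 ^ n * a n)) = F := by
    funext n; simp [hF]
  have e₂ : (fun n => s * 1 * (-1) ^ (p + k) * ((-1) ^ n * a n)) = J₂ p k F := by
    funext n; simp only [hF, J₂]; ring
  have e₃ : (fun n => s * -1 * (-1) ^ (p + k) * ((-1) ^ n * a n)) = J₃ p k F := by
    funext n; simp only [hF, J₃, hm, Nat.add_sub_cancel, pow_succ]; ring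
  have e₄ : (fun n => s * -1 * 1 ^ (p + k) * (1 ^ n * a n)) = J₂ p k (J₃ p k F) := by
    funext n
    have hn : ((-1 : ℝ) ^ n) ^ 2 = 1 := pow_sq_eq_one_of_sign (Or.inr rfl) n
    have hm' : ((-1 : ℝ) ^ m) ^ 2 = 1 := pow_sq_eq_one_of_sign (Or.inr rfl) m
    simp only [hF, J₂, J₃, hm, Nat.add_sub_cancel, pow_succ, one_pow]
    linear_combination s * a n * (hm' + ((-1 : ℝ) ^ m) ^ 2 * hn)
  rw [e₁] at hD₁
  rw [e₂] at hD₂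
  rw [e₃] at hD₃
  rw [e₄] at hD₄
  obtain ⟨ν, hν, hνD⟩ := exists_matching hk hD₁ hD₂ (coeffD_zero hp hk _) (coeffD_zero hp hk _)
  obtain ⟨ν', hν', hνD'⟩ := exists_matching hk hD₃ hD₄ (coeffD_zero hp hk _) (coeffD_zero hp hk _)
  refine ⟨fun x => x * ν x * ν' (x * ν x), hasSer_coeffZ hν hν', fun r hr => ?_⟩
  -- limits
  have hpos : ∀ {μ : ℝ → ℝ} {d d' : ℕ → ℝ}, HasSer μ (matchCoeff k d d') →
      Tendsto (fun x => x * μ x) (𝓝[>] 0) (𝓝[>] 0) := by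
    intro μ d d' hμ
    have hμc := hμ.analyticAt.continuousAt
    have hμ0 : μ 0 = 1 := by rw [hμ.apply_zero, matchCoeff_zero]
    have h1 : Tendsto (fun x => x * μ x) (𝓝 0) (𝓝 0) := by
      have : ContinuousAt (fun x => x * μ x) 0 := continuousAt_id.mul hμc
      simpa [ContinuousAt] using this
    have h2 : ∀ᶠ x in 𝓝 (0 : ℝ), 0 < μ x := hμc.eventually (lt_mem_nhds (by rw [hμ0]; exact one_pos))
    refine tendsto_nhdsWithin_iff.2 ⟨h1.mono_left nhdsWithin_le_nhds, ?_⟩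
    filter_upwards [self_mem_nhdsWithin, nhdsWithin_le_nhds h2] with x hx hx'
    exact mul_pos hx hx'
  have hh := hpos hν
  have hh' := hpos hν'
  have hZ := hh'.comp hh
  filter_upwards [h₁ r hr, hh.eventually (h₂ r hr), hh.eventually (h₃ r hr), hZ.eventually (h₄ r hr),
    nhdsWithin_le_nhds hνD, hh.eventually (nhdsWithin_le_nhds hνD'), self_mem_nhdsWithin,
    hh.eventually self_mem_nhdsWithin, hZ.eventually self_mem_nhdsWithin,
    hZ.eventually (nhdsWithin_le_nhds (gt_mem_nhds hr))] with ε q₁ q₂ q₃ q₄ m₁ m₂ hε hη hζ hζr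
  obtain ⟨y₁, hy₁, hy₁D, b₁, c₁, o₁, -⟩ := q₁
  obtain ⟨y₂, hy₂, hy₂D, -, c₂, -, o₂⟩ := q₂
  obtain ⟨y₃, hy₃, hy₃D, b₃, -, o₃, -⟩ := q₃
  obtain ⟨y₄, hy₄, hy₄D, -, c₄, -, o₄⟩ := q₄
  simp only [Function.comp_apply] at hy₄D c₄ o₄ hζ hζr
  set η := ε * ν ε with hη_def
  -- The matching equation equates the squares of the heights on `z = 0`, and both heights are
  -- positive.
  have hy₁₂ : y₂ = y₁ := by
    rw [← sq_eq_sq₀ hy₂.le hy₁.le, hy₁D, hy₂D, ← m₁, hη_def]; ring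
  have hy₃₄ : y₄ = y₃ := by
    rw [← sq_eq_sq₀ hy₄.le hy₃.le, hy₃D, hy₄D, ← m₂]; ring
  subst hy₁₂ hy₃₄
  replace o₁ := o₁ (by norm_num)
  replace o₂ := o₂ (by norm_num)
  replace o₃ := o₃ (by norm_num)
  replace o₄ := o₄ (by norm_num)
  simp only [one_mul] at o₁ o₄ c₁ c₄
  -- Halfway round, the orbit crosses `y = 0` again, but at `z < 0`, off the transversal; so this is
  -- not yet a return.
  have hmem : (-1 * η, (-1 * η) ^ (l + 1) * g (-1 * η) / f (-1 * η)) ∈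
      Metric.ball (0 : ℝ × ℝ) r \ arc l f g r := by
    refine ⟨c₂, fun h => ?_⟩
    have h1 : 0 < -1 * η := h.1
    have h2 : 0 < η := hη
    linarith
  exact ⟨hζ, hζr, c₁, c₄, ((o₁.trans b₁ o₂).trans hmem o₃).trans b₃ o₄⟩

/-- On the arc `f ẇ = k z^(2k-1) (f² + z^(2p) g²) > 0`. The field is therefore vertical and nonzero,
whereas the arc is a graph over the `z` axis. -/
theorem field_on_arc {k l p : ℕ} (hk : 1 ≤ k) (hl : p + k = l + 1) {f g : ℝ → ℝ} {r : ℝ}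
    {q : ℝ × ℝ} (hq : q ∈ arc l f g r) (hf : f q.1 ≠ 0) :
    (field k l f g q).1 = 0 ∧ (field k l f g q).2 ≠ 0 := by
  obtain ⟨h0, -, h⟩ := hq
  obtain ⟨z, w⟩ := q
  simp only [field] at *
  refine ⟨by linear_combination -h, fun h1 => ?_⟩
  have h2 : k * z ^ (2 * k - 1) * (f z ^ 2 + z ^ (2 * p) * g z ^ 2) = 0 := by
    have e : z ^ l * z ^ (l + 1) = z ^ (2 * k - 1) * z ^ (2 * p) := by
      rw [← pow_add, ← pow_add]; congr 1; omega
    linear_combination f z * h1 - k * z ^ l * g z * h - k * g z ^ 2 * e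
  have h3 : 0 < k * z ^ (2 * k - 1) * (f z ^ 2 + z ^ (2 * p) * g z ^ 2) := by
    have h4 : 0 < f z ^ 2 := by positivity
    have h5 : (0 : ℝ) < k := by exact_mod_cast hk
    positivity
  exact h3.ne' h2

theorem exists_lipschitz_field (k l : ℕ) {f g : ℝ → ℝ} (hf : AnalyticAt ℝ f 0)
    (hg : AnalyticAt ℝ g 0) :
    ∃ K : NNReal, ∃ R > 0, LipschitzOnWith K (field k l f g) (Metric.ball 0 R) := by
  have hf' : ContDiffAt ℝ 1 (fun q : ℝ × ℝ => f q.1) 0 :=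
    ContDiffAt.comp (g := f) (0 : ℝ × ℝ) hf.contDiffAt contDiffAt_fst
  have hg' : ContDiffAt ℝ 1 (fun q : ℝ × ℝ => g q.1) 0 :=
    ContDiffAt.comp (g := g) (0 : ℝ × ℝ) hg.contDiffAt contDiffAt_fst
  have hX : ContDiffAt ℝ 1 (field k l f g) 0 :=
    ((contDiffAt_snd.neg.mul hf').add ((contDiffAt_fst.pow _).mul hg')).prodMk
      (((contDiffAt_const.mul (contDiffAt_fst.pow _)).mul hf').add
        (((contDiffAt_const.mul contDiffAt_snd).mul (contDiffAt_fst.pow _)).mul hg'))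
  obtain ⟨K, t, ht, hK⟩ := hX.exists_lipschitzOnWith
  obtain ⟨R, hR, hRt⟩ := Metric.mem_nhds_iff.1 ht
  exact ⟨K, R, hR, hK.mono hRt⟩

end NilpotentReturn

theorem theorem1 (k l : ℕ) (hk : 1 ≤ k) (hkl : k < l + 1) (f g : ℝ → ℝ)
    (hf : AnalyticAt ℝ f 0) (hg : AnalyticAt ℝ g 0) (hf0 : f 0 ≠ 0)
    (p : ℕ) (hp : p = l + 1 - k)
    (F : ℕ → ℝ) (hF : F = NilpotentReturn.taylorF f g)
    (B₀ B₁ : ℝ) (hB₀ : B₀ = 2 * (p + 2 * k) * F 0) (hB₁ : B₁ = 2 * (p + 2 * k + 1) * F 1)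
    (θ : ℝ) (hθ : θ = NilpotentReturn.theta p k)
    (Zc : ℕ → ℝ) (hZc : Zc = NilpotentReturn.coeffZ p k F) :
    -- the system near the origin and the transversal
    ∃ r₀ > 0,
      (∀ z ∈ Set.Ioo (-r₀) r₀, AnalyticAt ℝ f z ∧ AnalyticAt ℝ g z ∧ f z ≠ 0) ∧
      (∀ q ∈ NilpotentReturn.arc l f g r₀,
        LinearIndependent ℝ ![((1 : ℝ), deriv (fun z => z ^ (l + 1) * g z / f z) q.1),
          NilpotentReturn.field k l f g q]) ∧
      -- the first return map is analytic, with the recursively computed coefficients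
      (∃ Z : ℝ → ℝ,
        HasFPowerSeriesAt Z (FormalMultilinearSeries.ofScalars ℝ Zc) 0 ∧
        ∀ r ∈ Set.Ioc 0 r₀, ∃ ε₀ > 0, ∀ ε ∈ Set.Ioo 0 ε₀, ∃ q' : ℝ × ℝ, q'.1 = Z ε ∧
          NilpotentReturn.IsFirstReturn (NilpotentReturn.field k l f g) (Metric.ball 0 r)
            (NilpotentReturn.arc l f g r) (ε, ε ^ (l + 1) * g ε / f ε) q') ∧
      -- the form of the series
      (Zc 0 = 0 ∧ Zc 1 = 1 ∧ ∀ n, 2 ≤ n → n < p + 1 → Zc n = 0) ∧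
      -- its first two nontrivial coefficients
      (2 ≤ p →
        Zc (p + 1) = 2 * (B₀ * NilpotentReturn.Phi p k 1 / (2 * k)) * (1 + θ) ∧
        Zc (p + 2) = 2 * (B₁ * NilpotentReturn.Phi (p + 1) k 1 / (2 * k)) * (1 - θ)) ∧
      (p = 1 →
        Zc 2 = 2 * (B₀ * NilpotentReturn.Phi 1 k 1 / (2 * k)) * (1 + θ) ∧
        Zc 3 = 2 * (((1 - θ) * B₁ * NilpotentReturn.Phi 2 k 1
              + (1 + θ) / k * B₀ ^ 2 * NilpotentReturn.Phi 1 k 1 ^ 2) / (2 * k)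
            + (B₀ * NilpotentReturn.Phi 1 k 1 / (2 * k) * (1 + θ)) ^ 2)) := by
  have hp1 : 1 ≤ p := by omega
  have hl : p + k = l + 1 := by omega
  have hφ : AnalyticAt ℝ (fun z => g z / f z) 0 := hg.div hf hf0
  obtain ⟨s, hs, hsign, hsf⟩ : ∃ s : ℝ, (s = 1 ∨ s = -1) ∧ Real.sign (f 0) = s ∧ 0 < s * f 0 := by
    rcases lt_or_gt_of_ne hf0 with h | h
    · exact ⟨-1, Or.inr rfl, Real.sign_of_neg h, by linarith⟩
    · exact ⟨1, Or.inl rfl, Real.sign_of_pos h, by linarith⟩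
  have hFs : (fun n => s * (iteratedDeriv n (fun z => g z / f z) 0 / (n.factorial : ℝ))) = F := by
    rw [hF]; funext n; rw [NilpotentReturn.taylorF, hsign]
  obtain ⟨Z, hZ, hret⟩ := NilpotentReturn.exists_return hk hp1 hl hf hs hsf
    (NilpotentReturn.hasSer_taylor hφ)
  rw [hFs, ← hZc] at hZ
  obtain ⟨K, R₁, hR₁, hLip⟩ := NilpotentReturn.exists_lipschitz_field k l hf hg
  obtain ⟨R₂, hR₂, hloc⟩ := Metric.eventually_nhds_iff.1 ((hf.eventually_analyticAt.and
    hg.eventually_analyticAt).and (hf.continuousAt.eventually_ne hf0))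
  have hloc' : ∀ z ∈ Set.Ioo (-(min R₁ R₂)) (min R₁ R₂),
      AnalyticAt ℝ f z ∧ AnalyticAt ℝ g z ∧ f z ≠ 0 := fun z hz => by
    have h := hloc (y := z) (by
      rw [dist_zero_right, Real.norm_eq_abs]
      exact (abs_lt.2 hz).trans_le (min_le_right _ _))
    exact ⟨h.1.1, h.1.2, h.2⟩
  have hr₀ : 0 < min R₁ R₂ := lt_min hR₁ hR₂
  -- `R₁` secures the Lipschitz bound behind uniqueness, `R₂` the analyticity of `f`, `g` and `f ≠
  -- 0`. The balls are for the sup norm, that is, squares `|z| < r`, `|w| < r`.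
  refine ⟨min R₁ R₂, hr₀, hloc', fun q hq => ?_, ⟨Z, hZ.hasFPowerSeriesAt_ofScalars,
    fun r hr => ?_⟩, ?_, fun h2 => ?_, fun h1 => ?_⟩
  · obtain ⟨h1, h2⟩ := NilpotentReturn.field_on_arc hk hl hq
      (hloc' q.1 ⟨by linarith [hq.1], hq.2.1⟩).2.2
    rw [LinearIndependent.pair_iff]
    intro a b hab
    have ha := congrArg Prod.fst hab
    have hb := congrArg Prod.snd hab
    simp only [Prod.fst_add, Prod.smul_fst, Prod.snd_add, Prod.smul_snd, smul_eq_mul, h1, mul_one,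
      mul_zero, add_zero, Prod.fst_zero, Prod.snd_zero] at ha hb
    subst ha
    simpa [h2] using hb
  · obtain ⟨ε₀, hε₀, hε⟩ := mem_nhdsGT_iff_exists_Ioo_subset.1 (hret r hr.1)
    refine ⟨ε₀, hε₀, fun ε hεm => ?_⟩
    obtain ⟨h1, h2, h3, h4, h5⟩ := hε hεm
    refine ⟨_, rfl, h5.isFirstReturn (hLip.mono (Metric.ball_subset_ball
      (hr.2.trans (min_le_left _ _)))) h3 h4 ⟨h1, h2, ?_⟩⟩
    have hfZ := (hloc' (Z ε) ⟨by linarith, h2.trans_le hr.2⟩).2.2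
    exact mul_div_cancel₀ _ hfZ
  · rw [hZc]
    exact NilpotentReturn.coeffZ_form hp1 hk F
  · rw [hZc, hB₀, hB₁, hθ]
    exact NilpotentReturn.coeffZ_of_two_le h2 hk F
  · subst h1
    rw [hZc, hB₀, hB₁, hθ]
    simpa using NilpotentReturn.coeffZ_one hk F
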